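/- Let $\Bbbk$ be a field, and let $\mathrm{dg}\Bbbk$ be the category of $\mathbb{Z}$-graded dg-modules over $\Bbbk$ (with differentials that lower degrees by one), with its standard model structure: the weak-equivalences are the quasi-isomorphisms, the fibrations are the degree-wise surjective morphisms, and the cofibrations are the morphisms with the left lifting property with respect to the acyclic fibrations. Let $\mathsf{E}$ be the non-unitary Barratt-Eccles operad: $\mathsf{E}(0)=0$ and $\mathsf{E}(r)=N_*(E\Sigma_r)$, the normalized chain complex of $E\Sigma_r$, for $r\ge 1$. Equip the category of $\mathsf{E}$-algebras in $\mathrm{dg}\Bbbk$ with the weak-equivalences and fibrations created by the forgetful functor $\omega$, and with the cofibrations determined by the left lifting property with respect to the acyclic fibrations. Let $S:\mathrm{dg}\Bbbk\to{}_{\mathsf{E}}\mathrm{dg}\Bbbk$ be the free $\mathsf{E}$-algebra functor, left adjoint to $\omega$. Let $A$ be any $\mathsf{E}$-algebra. Its cotriple resolution is the simplicial $\mathsf{E}$-algebra $\mathrm{Res}_\bullet(A)$ with $\mathrm{Res}_n(A)=S\circ\cdots\circ S(A)$ ($n+1$ factors $S$, numbered $0,\dots,n$ from left to right, with the forgetful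 functors omitted), where the face $d_i$ applies the adjunction counit to the $i$th factor and the degeneracy $s_j$ inserts the adjunction unit between the $j$th and the $(j+1)$th factors (after the last factor when $j=n$). Write $\mathrm{Res}_n(A)=S(C_n(A))$ with $C_n(A)=S\circ\cdots\circ S(A)$ ($n$ factors). The elements of $C_n(A)$ are linear combinations of tensors arranged on trees with $n$ levels, with vertices with $r$ ingoing edges labeled by elements of $\mathsf{E}(r)$ and leaves labeled by elements of $A$. Let $N_n C_\bullet(A)\subset C_n(A)$ be the dg-submodule spanned by the nondegenerate tree-wise tensors, those for which no level consists entirely of vertices with exactly one ingoing edge. The $n$th latching object $L_n X$ of a simplicial object $X$ is the colimit of the objects $X_m$ over the (opposite of the) category of surjections $[n]\to[m]$ of the simplex category with $m<n$, and the latching morphism $\lambda: L_nX\to X_n$ is induced by the degeneracy operators. Then: 1. $A$ is cofibrant as a dg-module. 2. The simplicial object $\mathrm{Res}_\bullet(A)$ is Reedy cofibrant: for each $n\ge 0$, the latching object $L_n\mathrm{Res}_\bullet(A)$ exists in the category of $\mathsf{E}$-algebras, and the latching morphism $\lambda: L_n\mathrm{Res}_\bullet(A)\to\mathrm{Res}_n(A)$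 is a cofibration of $\mathsf{E}$-algebras. 3. For each $n\ge 0$, the latching morphism $\lambda$ and the morphism $S(N_nC_\bullet(A))\to S(C_n(A))=\mathrm{Res}_n(A)$ induced by the inclusion exhibit $\mathrm{Res}_n(A)$ as the coproduct $L_n\mathrm{Res}_\bullet(A)\vee S(N_nC_\bullet(A))$ in the category of $\mathsf{E}$-algebras; thus $\lambda$ is the inclusion of a coproduct summand, with a free $\mathsf{E}$-algebra as complement. -/

import Mathlib

open CategoryTheory CategoryTheory.Limits

universe u

/-! ## Dg-modules -/

/-- A dg-module over `k`: a module with a decomposition `⨁ₙ Kₙ`, `n ∈ ℤ`, and a differential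
that lowers degrees by one. -/
structure DGModule (k : Type u) [Field k] where
  carrier : Type u
  [addCommGroup : AddCommGroup carrier]
  [module : Module k carrier]
  /-- the component of degree `n` -/
  gr : ℤ → Submodule k carrier
  isInternal : DirectSum.IsInternal gr
  /-- the differential -/
  d : carrier →ₗ[k] carrier
  d_mem : ∀ {n : ℤ} {x : carrier}, x ∈ gr n → d x ∈ gr (n - 1)
  d_d : ∀ x, d (d x) = 0

namespace DGModule

variable {k : Type u} [Field k]

instance : CoeSort (DGModule k) (Type u) := ⟨carrier⟩

instance (K : DGModule k) : AddCommGroup K := K.addCommGroup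

instance (K : DGModule k) : Module k K := K.module

/-- Morphisms of dg-modules: linear maps that preserve degrees and commute with `d`. -/
@[ext]
structure Hom (K L : DGModule k) where
  lin : K →ₗ[k] L
  map_gr : ∀ {n : ℤ} {x : K}, x ∈ K.gr n → lin x ∈ L.gr n
  map_d : ∀ x, lin (K.d x) = L.d (lin x)

instance : Category (DGModule k) where
  Hom := Hom
  id K := ⟨LinearMap.id, fun h => h, fun _ => rfl⟩
  comp f g := ⟨g.lin ∘ₗ f.lin, fun h => g.map_gr (f.map_gr h),
    fun x => by simp [f.map_d, g.map_d]⟩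

@[ext]
theorem hom_ext {K L : DGModule k} {f g : K ⟶ L} (h : ∀ x, f.lin x = g.lin x) : f = g :=
  Hom.ext (LinearMap.ext h)

/-- The cycles. -/
def cycles (K : DGModule k) : Submodule k K := LinearMap.ker K.d

/-- The boundaries, as a submodule of the cycles. -/
def boundaries (K : DGModule k) : Submodule k K.cycles :=
  (LinearMap.range K.d).comap K.cycles.subtype

/-- The (total) homology. -/
abbrev homology (K : DGModule k) : Type u := K.cycles ⧸ K.boundaries

/-- The map induced by a morphism on cycles. -/
def Hom.cyclesMap {K L : DGModule k} (f : Hom K L) : K.cycles →ₗ[k] L.cycles :=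
  f.lin.restrict fun x hx => by
    rw [cycles, LinearMap.mem_ker] at hx ⊢
    rw [← f.map_d, hx, map_zero]

/-- The map induced by a morphism in homology. -/
def Hom.homologyMap {K L : DGModule k} (f : Hom K L) : K.homology →ₗ[k] L.homology :=
  Submodule.mapQ _ _ f.cyclesMap (by
    rintro ⟨x, hx⟩ ⟨y, hy⟩
    exact ⟨f.lin y, by rw [← f.map_d, hy]; rfl⟩)

/-- Weak-equivalences: the morphisms that induce an isomorphism in homology. -/
def weakEquivalences (k : Type u) [Field k] : MorphismProperty (DGModule k) :=
  fun _ _ f => Function.Bijective f.homologyMap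

/-- Fibrations: the degree-wise surjective morphisms. -/
def fibrations (k : Type u) [Field k] : MorphismProperty (DGModule k) :=
  fun K L f => ∀ n : ℤ, ∀ y ∈ L.gr n, ∃ x ∈ K.gr n, f.lin x = y

/-- Cofibrations: the morphisms with the left lifting property with respect to the
acyclic fibrations. -/
def cofibrations (k : Type u) [Field k] : MorphismProperty (DGModule k) :=
  (fibrations k ⊓ weakEquivalences k).llp

/-- A dg-module is cofibrant when the morphism from an initial object is a cofibration. -/
def IsCofibrant (K : DGModule k) : Prop :=
  ∃ (Z : DGModule k) (hZ : IsInitial Z), cofibrations k (hZ.to K)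

/-- A criterion for a family of submodules to be a grading. -/
theorem isInternal_of_proj {V : Type*} [AddCommGroup V] [Module k V] (g : ℤ → Submodule k V)
    (π : ℤ → V →ₗ[k] V) (h1 : ∀ n, ∀ x ∈ g n, π n x = x)
    (h2 : ∀ m n, m ≠ n → ∀ x ∈ g m, π n x = 0) (h3 : ⨆ n, g n = ⊤) :
    DirectSum.IsInternal g := by
  refine (DirectSum.isInternal_submodule_iff_iSupIndep_and_iSup_eq_top g).2 ⟨?_, h3⟩
  rw [iSupIndep_def]
  intro n
  rw [Submodule.disjoint_def]
  intro x hx hx'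
  rw [← h1 n x hx]
  have : (⨆ (j) (_ : j ≠ n), g j) ≤ LinearMap.ker (π n) :=
    iSup_le fun j => iSup_le fun hj => fun y hy => h2 j n hj y hy
  exact this hx'

theorem iSup_gr (K : DGModule k) : ⨆ n, K.gr n = ⊤ := K.isInternal.submodule_iSup_eq_top

/-- The dg-submodule spanned by a set of homogeneous elements, when its span is closed under
the differential. -/
def ofSpan (K : DGModule k) (s : Set K) (hs : ∀ x ∈ s, ∃ n, x ∈ K.gr n)
    (hd : ∀ x ∈ s, K.d x ∈ Submodule.span k s) : DGModule k where
  carrier := Submodule.span k s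
  gr n := (K.gr n).comap (Submodule.span k s).subtype
  isInternal := by
    refine (DirectSum.isInternal_submodule_iff_iSupIndep_and_iSup_eq_top _).2 ⟨?_, ?_⟩
    · rw [iSupIndep_def]
      intro n
      rw [Submodule.disjoint_def]
      intro x hx hx'
      have h1 := K.isInternal.submodule_iSupIndep
      rw [iSupIndep_def] at h1
      have h2 := (Submodule.disjoint_def.1 (h1 n)) x.1 hx
      refine Subtype.ext (h2 ?_)
      have h3 : (⨆ (j) (_ : j ≠ n), (K.gr j).comap (Submodule.span k s).subtype) ≤
          (⨆ (j) (_ : j ≠ n), K.gr j).comap (Submodule.span k s).subtype :=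
        iSup_le fun j => iSup_le fun hj => Submodule.comap_mono (le_iSup₂_of_le j hj le_rfl)
      exact h3 hx'
    · rw [eq_top_iff]
      rintro ⟨x, hx⟩ -
      induction hx using Submodule.span_induction with
      | mem x h =>
        obtain ⟨n, hn⟩ := hs x h
        exact Submodule.mem_iSup_of_mem n hn
      | zero => exact Submodule.zero_mem _
      | add x y hx hy h1 h2 => exact Submodule.add_mem _ h1 h2
      | smul c x hx h1 => exact Submodule.smul_mem _ c h1
  d := K.d.restrict (p := Submodule.span k s) (q := Submodule.span k s) (by
    intro x hx
    exact (Submodule.span_le (p := (Submodule.span k s).comap K.d)).2 hd hx)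
  d_mem := fun h => K.d_mem h
  d_d := fun x => Subtype.ext (K.d_d x.1)

/-- The inclusion of a dg-submodule. -/
def ofSpanIncl (K : DGModule k) (s : Set K) (hs : ∀ x ∈ s, ∃ n, x ∈ K.gr n)
    (hd : ∀ x ∈ s, K.d x ∈ Submodule.span k s) : K.ofSpan s hs hd ⟶ K :=
  Hom.mk (Submodule.span k s).subtype (fun h => h) (fun _ => rfl)

end DGModule

/-! ## The Barratt-Eccles operad -/

/-- The nondegenerate simplices `(w₀, …, w_d)` of the simplicial set `EΣ_r`, for `r > 0`. -/
@[ext]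
structure BESimplex (r : ℕ) where
  pos : 0 < r
  dim : ℕ
  vertex : Fin (dim + 1) → Equiv.Perm (Fin r)
  nondeg : ∀ i : Fin dim, vertex i.castSucc ≠ vertex i.succ

/-- The term of arity `r` of the (non-unitary) Barratt-Eccles operad: the normalized chain
complex of `EΣ_r` when `r > 0`, and zero when `r = 0`. -/
abbrev BarrattEccles (k : Type u) [Field k] (r : ℕ) : Type u := BESimplex r →₀ k

namespace BarrattEccles

variable {k : Type u} [Field k]

/-- The component of degree `q`. -/
def gr (k : Type u) [Field k] (r q : ℕ) : Submodule k (BarrattEccles k r) :=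
  Finsupp.supported k k {σ | σ.dim = q}

open Classical in
/-- The class of a simplex of `EΣ_r` in the normalized chain complex; degenerate simplices
are sent to zero. -/
noncomputable def cls (k : Type u) [Field k] {r d : ℕ} (w : Fin (d + 1) → Equiv.Perm (Fin r)) :
    BarrattEccles k r :=
  if h : 0 < r ∧ ∀ i : Fin d, w i.castSucc ≠ w i.succ then
    Finsupp.single ⟨h.1, d, w, h.2⟩ 1
  else 0

/-- The alternating sum of the faces of a simplex. -/
noncomputable def faceSum (k : Type u) [Field k] {r : ℕ} :
    (d : ℕ) → (Fin (d + 1) → Equiv.Perm (Fin r)) → BarrattEccles k r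
  | 0, _ => 0
  | d + 1, w => ∑ i : Fin (d + 2), (i.val : ℤ).negOnePow • cls k (w ∘ i.succAbove)

/-- The differential. -/
noncomputable def d (k : Type u) [Field k] (r : ℕ) : BarrattEccles k r →ₗ[k] BarrattEccles k r :=
  Finsupp.linearCombination k fun σ => faceSum k σ.dim σ.vertex

/-- The left action of a permutation `s`: `(w₀, …, w_d) ↦ (s w₀, …, s w_d)`. -/
noncomputable def perm (k : Type u) [Field k] {r : ℕ} (s : Equiv.Perm (Fin r)) :
    BarrattEccles k r →ₗ[k] BarrattEccles k r :=
  Finsupp.linearCombination k fun σ => cls k fun j => s * σ.vertex j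

/-- The operad unit, in arity one. -/
noncomputable def one (k : Type u) [Field k] : BarrattEccles k 1 :=
  cls k (d := 0) fun _ => 1

/-- The input of the operation `u` (of arity `m + 1`) to which the input `x` of the partial
composite `u ∘ᵢ v` belongs, where `v` (of arity `n`) is plugged into the input `i`. -/
def outerInput {m n : ℕ} (i : Fin (m + 1)) (x : Fin (m + n)) : Fin (m + 1) :=
  if x.val < i.val then ⟨x.val ⊓ m, by omega⟩
  else if x.val < i.val + n then i
  else ⟨x.val + 1 - n, by omega⟩

/-- The place of the input `x` of `u ∘ᵢ v` in the order of inputs: a permutation `w` stands for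
the order `w 0, w 1, …` of the inputs, so that `w⁻¹ x` is the position of `x`. We compare the
positions in `u` first, and the positions in `v` next. -/
def compKey {m n : ℕ} (i : Fin (m + 1)) (u : Equiv.Perm (Fin (m + 1))) (v : Equiv.Perm (Fin n))
    (x : Fin (m + n)) : ℕ ×ₗ ℕ :=
  toLex (u⁻¹ (outerInput i x),
    if h : i.val ≤ x.val ∧ x.val < i.val + n then (v⁻¹ ⟨x.val - i.val, by omega⟩).val else 0)

/-- The partial composite `u ∘ᵢ v` in the permutation operad: in the sequence `u 0, u 1, …`, the
entry `i` is replaced by the sequence `v` (shifted by `i`). -/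
def permComp {m n : ℕ} (i : Fin (m + 1)) (u : Equiv.Perm (Fin (m + 1)))
    (v : Equiv.Perm (Fin n)) : Equiv.Perm (Fin (m + n)) :=
  Tuple.sort (compKey i u v)

open Classical in
/-- The sign exponent of the shuffle determined by a lattice path `φ` from `(0, 0)` to `(p, q)`:
the number of pairs that consist of a horizontal step `a` and a vertical step `b` such that
`b` comes before `a`. -/
noncomputable def pathInv {p q : ℕ} (φ : Fin (p + q + 1) → Fin (p + 1) × Fin (q + 1)) : ℕ :=
  (Finset.univ.filter fun ab : Fin p × Fin q =>
    ∃ j, (φ j).1 ≤ ab.1.castSucc ∧ ab.2.succ ≤ (φ j).2).card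

open Classical in
/-- The partial composition operations: the composition operations of the simplicial operad
`EΣ_•` together with the Eilenberg-Zilber (shuffle) map, where the maximal strictly increasing
maps `φ` are the lattice paths. -/
noncomputable def comp (k : Type u) [Field k] {m n : ℕ} (i : Fin (m + 1)) :
    BarrattEccles k (m + 1) →ₗ[k] BarrattEccles k n →ₗ[k] BarrattEccles k (m + n) :=
  Finsupp.linearCombination k fun σ => Finsupp.linearCombination k fun τ =>
    ∑ φ : Fin (σ.dim + τ.dim + 1) → Fin (σ.dim + 1) × Fin (τ.dim + 1) with StrictMono φ,
      (pathInv φ : ℤ).negOnePow •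
        cls k fun j => permComp i (σ.vertex (φ j).1) (τ.vertex (φ j).2)

end BarrattEccles

/-! ## Algebras over the Barratt-Eccles operad -/

/-- The exponent of the Koszul sign of `a₀ ⊗ a₁ ⊗ ⋯ ↦ a_{s 0} ⊗ a_{s 1} ⊗ ⋯` for elements of
degrees `p₀, p₁, …`. -/
def koszulExp {r : ℕ} (s : Equiv.Perm (Fin r)) (p : Fin r → ℤ) : ℤ :=
  ∑ ij : Fin r × Fin r with ij.1 < ij.2 ∧ s ij.2 < s ij.1, p (s ij.1) * p (s ij.2)

/-- The inputs `a_i, …, a_{i+n-1}` of the inner operation of a partial composite. -/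
def innerArgs {V : Type*} {m n : ℕ} (i : Fin (m + 1)) (a : Fin (m + n) → V) : Fin n → V :=
  fun l => a ⟨i.val + l.val, by omega⟩

/-- The inputs `a_0, …, a_{i-1}, y, a_{i+n}, …` of the outer operation of a partial composite. -/
def outerArgs {V : Type*} {m n : ℕ} (i : Fin (m + 1)) (a : Fin (m + n) → V) (y : V) :
    Fin (m + 1) → V :=
  fun j => if h : j.val < i.val then a ⟨j.val, by omega⟩
    else if h' : j.val = i.val then y
    else a ⟨j.val - 1 + n, by omega⟩

/-- Algebras over the Barratt-Eccles operad in dg-modules. The operation associated to `e` and to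
the inputs `a₀, …, a_{r-1}` is written `act r e a`. -/
structure BEAlgebra (k : Type u) [Field k] where
  dg : DGModule k
  act : ∀ r, BarrattEccles k r →ₗ[k] MultilinearMap k (fun _ : Fin r => dg) dg
  act_mem : ∀ {r q : ℕ} {e : BarrattEccles k r} {a : Fin r → dg} {p : Fin r → ℤ},
    e ∈ BarrattEccles.gr k r q → (∀ i, a i ∈ dg.gr (p i)) → act r e a ∈ dg.gr (q + ∑ i, p i)
  d_act : ∀ {r q : ℕ} {e : BarrattEccles k r} {a : Fin r → dg} {p : Fin r → ℤ},
    e ∈ BarrattEccles.gr k r q → (∀ i, a i ∈ dg.gr (p i)) →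
    dg.d (act r e a) = act r (BarrattEccles.d k r e) a +
      ∑ i, (q + ∑ j with j < i, p j).negOnePow • act r e (Function.update a i (dg.d (a i)))
  act_perm : ∀ {r : ℕ} (s : Equiv.Perm (Fin r)) (e : BarrattEccles k r) {a : Fin r → dg}
    {p : Fin r → ℤ}, (∀ i, a i ∈ dg.gr (p i)) →
    act r (BarrattEccles.perm k s e) a = (koszulExp s p).negOnePow • act r e fun i => a (s i)
  act_one : ∀ a : Fin 1 → dg, act 1 (BarrattEccles.one k) a = a 0
  act_comp : ∀ {m n q : ℕ} (i : Fin (m + 1)) (e : BarrattEccles k (m + 1))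
    {f : BarrattEccles k n} {a : Fin (m + n) → dg} {p : Fin (m + n) → ℤ},
    f ∈ BarrattEccles.gr k n q → (∀ j, a j ∈ dg.gr (p j)) →
    act (m + 1) e (outerArgs i a (act n f (innerArgs i a))) =
      (q * ∑ j with j.val < i.val, p j).negOnePow • act (m + n) (BarrattEccles.comp k i e f) a

namespace BEAlgebra

variable {k : Type u} [Field k]

/-- Morphisms of algebras over the Barratt-Eccles operad. -/
@[ext]
structure Hom (A B : BEAlgebra k) where
  dgHom : A.dg ⟶ B.dg
  map_act : ∀ {r : ℕ} (e : BarrattEccles k r) (a : Fin r → A.dg),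
    dgHom.lin (A.act r e a) = B.act r e fun i => dgHom.lin (a i)

instance : Category (BEAlgebra k) where
  Hom := Hom
  id A := ⟨𝟙 A.dg, fun _ _ => rfl⟩
  comp f g := ⟨f.dgHom ≫ g.dgHom, fun e a =>
    (congrArg g.dgHom.lin (f.map_act e a)).trans (g.map_act e _)⟩

@[ext]
theorem hom_ext {A B : BEAlgebra k} {f g : A ⟶ B} (h : f.dgHom = g.dgHom) : f = g :=
  Hom.ext h

/-- The forgetful functor to dg-modules. -/
def forget (k : Type u) [Field k] : BEAlgebra k ⥤ DGModule k where
  obj A := A.dg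
  map f := f.dgHom

/-- Weak-equivalences and fibrations of algebras are created by the forgetful functor. -/
def weakEquivalences (k : Type u) [Field k] : MorphismProperty (BEAlgebra k) :=
  (DGModule.weakEquivalences k).inverseImage (forget k)

/-- Weak-equivalences and fibrations of algebras are created by the forgetful functor. -/
def fibrations (k : Type u) [Field k] : MorphismProperty (BEAlgebra k) :=
  (DGModule.fibrations k).inverseImage (forget k)

/-- Cofibrations of algebras: the morphisms with the left lifting property with respect to the
acyclic fibrations. -/
def cofibrations (k : Type u) [Field k] : MorphismProperty (BEAlgebra k) :=
  (fibrations k ⊓ weakEquivalences k).llp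

end BEAlgebra

/-! ## Free algebras -/

/-- A property of tuples of vectors which is linear in each variable holds on spans when it
holds on generators. -/
theorem MultilinearMap.mem_of_span {k V W : Type*} [Field k] [AddCommGroup V] [Module k V]
    [AddCommGroup W] [Module k W] {r : ℕ} (f : MultilinearMap k (fun _ : Fin r => V) W)
    (I : Submodule k W) (G : Fin r → Set V) (h : ∀ y : Fin r → V, (∀ i, y i ∈ G i) → f y ∈ I)
    (x : Fin r → V) (hx : ∀ i, x i ∈ Submodule.span k (G i)) : f x ∈ I := by
  classical
  suffices H : ∀ s : Finset (Fin r), ∀ x : Fin r → V, (∀ i ∈ s, x i ∈ Submodule.span k (G i)) →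
      (∀ i ∉ s, x i ∈ G i) → f x ∈ I from
    H Finset.univ x (fun i _ => hx i) (fun i hi => absurd (Finset.mem_univ i) hi)
  intro s
  induction s using Finset.induction_on with
  | empty => exact fun x _ h2 => h x fun i => h2 i (Finset.notMem_empty i)
  | insert a s ha ih =>
    intro x h1 h2
    have key : ∀ z ∈ Submodule.span k (G a), f (Function.update x a z) ∈ I := by
      intro z hz
      induction hz using Submodule.span_induction with
      | mem z hz =>
        refine ih _ (fun i hi => ?_) (fun i hi => ?_)
        · rw [Function.update_of_ne (by rintro rfl; exact ha hi)]
          exact h1 i (Finset.mem_insert_of_mem hi)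
        · by_cases hia : i = a
          · subst hia; simpa using hz
          · rw [Function.update_of_ne hia]
            exact h2 i (by simp [hia, hi])
      | zero => rw [f.map_update_zero]; exact I.zero_mem
      | add u v _ _ hu hv => rw [f.map_update_add]; exact I.add_mem hu hv
      | smul c u _ hu => rw [f.map_update_smul]; exact I.smul_mem c hu
    have := key (x a) (h1 a (Finset.mem_insert_self a s))
    rwa [Function.update_eq_self] at this

namespace BarrattEccles

variable {k : Type u} [Field k]

theorem gr_eq_span (r q : ℕ) : gr k r q =
    Submodule.span k ((fun σ : BESimplex r => Finsupp.single σ (1 : k)) '' {σ | σ.dim = q}) :=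
  Finsupp.supported_eq_span_single k _

theorem cls_mem {r d : ℕ} (w : Fin (d + 1) → Equiv.Perm (Fin r)) : cls k w ∈ gr k r d := by
  unfold cls
  split_ifs with h
  · exact Finsupp.single_mem_supported k _ rfl
  · exact Submodule.zero_mem _

theorem negOnePow_smul_mem {V : Type*} [AddCommGroup V] [Module k V] (W : Submodule k V) (n : ℤ)
    {x : V} (hx : x ∈ W) : n.negOnePow • x ∈ W := by
  rw [Units.smul_def]
  exact W.toAddSubgroup.zsmul_mem hx _

theorem d_single_mem {r : ℕ} (σ : BESimplex r) (q : ℕ) (h : σ.dim = q + 1) :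
    d k r (Finsupp.single σ 1) ∈ gr k r q := by
  obtain ⟨pos, dim, w, nd⟩ := σ
  obtain rfl : dim = q + 1 := h
  simp only [d, Finsupp.linearCombination_single, one_smul, faceSum]
  exact Submodule.sum_mem _ fun i _ => negOnePow_smul_mem _ _ (cls_mem _)

theorem d_single_zero {r : ℕ} (σ : BESimplex r) (h : σ.dim = 0) :
    d k r (Finsupp.single σ 1) = 0 := by
  obtain ⟨pos, dim, w, nd⟩ := σ
  obtain rfl : dim = 0 := h
  simp [d, Finsupp.linearCombination_single, faceSum]

end BarrattEccles

/-- Formal expressions in elements of `M` and in operations of the Barratt-Eccles operad. -/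
inductive FreeTerm {k : Type u} [Field k] (M : DGModule k) : Type u
  | of (p : ℤ) (x : M.gr p) : FreeTerm M
  | node {r : ℕ} (σ : BESimplex r) (t : Fin r → FreeTerm M) : FreeTerm M

namespace FreeTerm

variable {k : Type u} [Field k] {M : DGModule k}

/-- The degree of an expression. -/
def deg : FreeTerm M → ℤ
  | of p _ => p
  | node σ t => σ.dim + ∑ i, (t i).deg

/-- Linear combinations of expressions. -/
abbrev Lin (M : DGModule k) : Type u := FreeTerm M →₀ k

/-- An expression, regarded as a linear combination. -/
noncomputable abbrev gen (t : FreeTerm M) : Lin M := Finsupp.single t 1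

/-- The multilinear extension of `node σ`. -/
noncomputable def op {r : ℕ} (σ : BESimplex r) :
    MultilinearMap k (fun _ : Fin r => Lin M) (Lin M) where
  toFun x := Finsupp.mapDomain (node σ)
    (Finsupp.onFinset (Fintype.piFinset fun i => (x i).support) (fun t => ∏ i, x i (t i))
      (fun t ht => Fintype.mem_piFinset.2 fun i => Finsupp.mem_support_iff.2 fun h0 =>
        ht (Finset.prod_eq_zero (Finset.mem_univ i) h0)))
  map_update_add' := by
    intro _ x i u v
    rw [← Finsupp.mapDomain_add]
    congr 1
    ext t
    have := ((MultilinearMap.mkPiAlgebra k (Fin r) k).compLinearMap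
      fun i => Finsupp.lapply (t i)).map_update_add x i u v
    simpa only [MultilinearMap.compLinearMap_apply, MultilinearMap.mkPiAlgebra_apply,
      Finsupp.lapply_apply, Finsupp.coe_add, Pi.add_apply, Finsupp.onFinset_apply] using this
  map_update_smul' := by
    intro _ x i c u
    rw [← Finsupp.mapDomain_smul]
    congr 1
    ext t
    have := ((MultilinearMap.mkPiAlgebra k (Fin r) k).compLinearMap
      fun i => Finsupp.lapply (t i)).map_update_smul x i c u
    simpa only [MultilinearMap.compLinearMap_apply, MultilinearMap.mkPiAlgebra_apply,
      Finsupp.lapply_apply, Finsupp.coe_smul, Pi.smul_apply, Finsupp.onFinset_apply] using this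

theorem op_gen {r : ℕ} (σ : BESimplex r) (t : Fin r → FreeTerm M) :
    op σ (fun i => gen (t i)) = gen (node σ t) := by
  change Finsupp.mapDomain (node σ) _ = _
  rw [gen, ← Finsupp.mapDomain_single]
  congr 1
  ext t'
  rw [Finsupp.onFinset_apply]
  by_cases h : t = t'
  · subst h; simp
  · rw [Finsupp.single_eq_of_ne' h]
    obtain ⟨i, hi⟩ := Function.ne_iff.1 h
    exact Finset.prod_eq_zero (Finset.mem_univ i) (Finsupp.single_eq_of_ne' hi)

/-- The operations on linear combinations of expressions. -/
noncomputable def actLin (M : DGModule k) (r : ℕ) :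
    BarrattEccles k r →ₗ[k] MultilinearMap k (fun _ : Fin r => Lin M) (Lin M) :=
  Finsupp.linearCombination k op

theorem actLin_single {r : ℕ} (σ : BESimplex r) :
    actLin M r (Finsupp.single σ 1) = op σ := by simp [actLin]

/-- The differential of an expression. -/
noncomputable def dTerm : FreeTerm M → Lin M
  | of p x => gen (of (p - 1) ⟨M.d x, M.d_mem x.2⟩)
  | node (r := r) σ t =>
    actLin M r (BarrattEccles.d k r (Finsupp.single σ 1)) (fun i => gen (t i)) +
      ∑ i, (σ.dim + ∑ j with j < i, (t j).deg).negOnePow •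
        op σ (Function.update (fun j => gen (t j)) i (t i).dTerm)

/-- The differential of linear combinations of expressions. -/
noncomputable def dLin (M : DGModule k) : Lin M →ₗ[k] Lin M :=
  Finsupp.linearCombination k dTerm

theorem dLin_gen (t : FreeTerm M) : dLin M (gen t) = dTerm t := by simp [dLin]

/-- The component of degree `n`. -/
def grLin (M : DGModule k) (n : ℤ) : Submodule k (Lin M) :=
  Finsupp.supported k k {t | t.deg = n}

/-- The relations of an algebra over the Barratt-Eccles operad. -/
inductive Rel (M : DGModule k) : Lin M → Prop
  | add (p : ℤ) (x y : M.gr p) : Rel M (gen (of p (x + y)) - gen (of p x) - gen (of p y))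
  | smul (p : ℤ) (c : k) (x : M.gr p) : Rel M (gen (of p (c • x)) - c • gen (of p x))
  | perm {r : ℕ} (s : Equiv.Perm (Fin r)) (σ : BESimplex r) (t : Fin r → FreeTerm M) :
    Rel M (actLin M r (BarrattEccles.perm k s (Finsupp.single σ 1)) (fun i => gen (t i)) -
      (koszulExp s fun i => (t i).deg).negOnePow • op σ fun i => gen (t (s i)))
  | one (t : Fin 1 → FreeTerm M) :
    Rel M (actLin M 1 (BarrattEccles.one k) (fun i => gen (t i)) - gen (t 0))
  | comp {m n : ℕ} (i : Fin (m + 1)) (σ : BESimplex (m + 1)) (τ : BESimplex n)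
      (t : Fin (m + n) → FreeTerm M) :
    Rel M (op σ (outerArgs i (fun j => gen (t j)) (op τ (innerArgs i fun j => gen (t j)))) -
      (τ.dim * ∑ j with j.val < i.val, (t j).deg).negOnePow •
        actLin M (m + n) (BarrattEccles.comp k i (Finsupp.single σ 1) (Finsupp.single τ 1))
          (fun j => gen (t j)))
  | d_d (t : FreeTerm M) : Rel M (dLin M (dLin M (gen t)))
  | d (x : Lin M) : Rel M x → Rel M (dLin M x)
  | op {r : ℕ} (σ : BESimplex r) (t : Fin r → FreeTerm M) (i : Fin r) (x : Lin M) :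
    Rel M x → Rel M (op σ (Function.update (fun j => gen (t j)) i x))

/-- The submodule spanned by the relations. -/
noncomputable def ideal (M : DGModule k) : Submodule k (Lin M) := Submodule.span k {x | Rel M x}

theorem gen_mem (t : FreeTerm M) : gen t ∈ grLin M t.deg := Finsupp.single_mem_supported k _ rfl

theorem grLin_eq (n : ℤ) : grLin M n = Submodule.span k (gen '' {t : FreeTerm M | t.deg = n}) :=
  Finsupp.supported_eq_span_single k _

theorem span_gen : Submodule.span k (Set.range (gen : FreeTerm M → Lin M)) = ⊤ := by
  rw [eq_top_iff]
  intro x _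
  induction x using Finsupp.induction_linear with
  | zero => exact Submodule.zero_mem _
  | add x y hx hy => exact Submodule.add_mem _ (hx trivial) (hy trivial)
  | single t c =>
    rw [← mul_one c, ← smul_eq_mul, ← Finsupp.smul_single]
    exact Submodule.smul_mem _ _ (Submodule.subset_span ⟨t, rfl⟩)

theorem op_mem {r : ℕ} (σ : BESimplex r) {x : Fin r → Lin M} {p : Fin r → ℤ}
    (h : ∀ i, x i ∈ grLin M (p i)) : op σ x ∈ grLin M (σ.dim + ∑ i, p i) := by
  refine (op σ).mem_of_span _ (fun i => gen '' {t | t.deg = p i}) ?_ x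
    fun i => by rw [← grLin_eq]; exact h i
  intro y hy
  choose t ht hty using hy
  obtain rfl : (fun i => gen (t i)) = y := funext hty
  rw [op_gen]
  have : (node σ t).deg = σ.dim + ∑ i, p i := by
    rw [deg]; exact congrArg _ (Finset.sum_congr rfl fun i _ => ht i)
  rw [← this]
  exact gen_mem _

theorem actLin_mem {r q : ℕ} {e : BarrattEccles k r} (he : e ∈ BarrattEccles.gr k r q)
    {x : Fin r → Lin M} {p : Fin r → ℤ} (h : ∀ i, x i ∈ grLin M (p i)) :
    actLin M r e x ∈ grLin M (q + ∑ i, p i) := by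
  rw [BarrattEccles.gr_eq_span] at he
  induction he using Submodule.span_induction with
  | mem e he =>
    obtain ⟨σ, rfl, rfl⟩ := he
    rw [actLin_single]
    exact op_mem σ h
  | zero => simp
  | add e f _ _ he hf => rw [map_add]; exact Submodule.add_mem _ he hf
  | smul c e _ he => rw [map_smul]; exact Submodule.smul_mem _ c he

theorem sum_update {r : ℕ} (p : Fin r → ℤ) (i : Fin r) (c : ℤ) :
    ∑ j, Function.update p i (p i + c) j = ∑ j, p j + c := by
  classical
  rw [Finset.sum_update_of_mem (Finset.mem_univ i), ← Finset.add_sum_erase _ p (Finset.mem_univ i),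
    Finset.sdiff_singleton_eq_erase]
  ring

theorem dTerm_mem (t : FreeTerm M) : dTerm t ∈ grLin M (t.deg - 1) := by
  induction t with
  | of p x => exact gen_mem _
  | node σ t ih =>
    rw [dTerm, deg]
    refine Submodule.add_mem _ ?_ (Submodule.sum_mem _ fun i _ =>
      BarrattEccles.negOnePow_smul_mem _ _ ?_)
    · rcases Nat.eq_zero_or_pos σ.dim with h | h
      · rw [BarrattEccles.d_single_zero σ h]; simp
      · obtain ⟨q, hq⟩ := Nat.exists_eq_succ_of_ne_zero h.ne'
        have := actLin_mem (BarrattEccles.d_single_mem (k := k) σ q hq)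
          (fun i => gen_mem (M := M) (t i))
        rw [hq]
        convert this using 2
        push_cast
        ring
    · have := op_mem (M := M) σ (x := Function.update (fun j => gen (t j)) i (t i).dTerm)
        (p := Function.update (fun j => (t j).deg) i ((t i).deg + -1)) (fun j => by
          by_cases hj : j = i
          · subst hj; simpa [sub_eq_add_neg] using ih j
          · simpa [Function.update_of_ne hj] using gen_mem (t j))
      rw [sum_update (fun j => (t j).deg)] at this
      convert this using 2
      ring

theorem dLin_mem {n : ℤ} {x : Lin M} (hx : x ∈ grLin M n) : dLin M x ∈ grLin M (n - 1) := by
  rw [grLin_eq] at hx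
  induction hx using Submodule.span_induction with
  | mem x h => obtain ⟨t, rfl, rfl⟩ := h; rw [dLin_gen]; exact dTerm_mem t
  | zero => simp
  | add x y _ _ h1 h2 => rw [map_add]; exact Submodule.add_mem _ h1 h2
  | smul c x _ h1 => rw [map_smul]; exact Submodule.smul_mem _ c h1

/-- The operad action on linear combinations of expressions satisfies the Leibniz rule. -/
theorem dLin_op {r : ℕ} (σ : BESimplex r) {x : Fin r → Lin M} {p : Fin r → ℤ}
    (h : ∀ i, x i ∈ grLin M (p i)) :
    dLin M (op σ x) = actLin M r (BarrattEccles.d k r (Finsupp.single σ 1)) x +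
      ∑ i, (σ.dim + ∑ j with j < i, p j).negOnePow •
        op σ (Function.update x i (dLin M (x i))) := by
  classical
  let D : MultilinearMap k (fun _ : Fin r => Lin M) (Lin M) :=
    (dLin M).compMultilinearMap (op σ) -
      (actLin M r (BarrattEccles.d k r (Finsupp.single σ 1)) +
        ∑ i, (σ.dim + ∑ j with j < i, p j).negOnePow •
          (op σ).compLinearMap (Function.update (fun _ => LinearMap.id) i (dLin M)))
  have hD : ∀ y, D y = dLin M (op σ y) -
      (actLin M r (BarrattEccles.d k r (Finsupp.single σ 1)) y +
      ∑ i, (σ.dim + ∑ j with j < i, p j).negOnePow •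
        op σ (Function.update y i (dLin M (y i)))) := by
    intro y
    simp only [D, sub_apply, add_apply, sum_apply, smul_apply, LinearMap.compMultilinearMap_apply,
      MultilinearMap.compLinearMap_apply]
    congr 3
    ext1 i
    congr 3
    ext1 j
    by_cases hj : j = i
    · subst hj; simp
    · simp [Function.update_of_ne hj]
  have := D.mem_of_span ⊥ (fun i => gen '' {t | t.deg = p i}) (fun y hy => by
    choose t ht hty using hy
    obtain rfl : (fun i => gen (t i)) = y := funext hty
    obtain rfl : (fun i => (t i).deg) = p := funext ht
    rw [Submodule.mem_bot, hD, sub_eq_zero, op_gen, dLin_gen, dTerm]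
    simp only [dLin_gen]) x fun i => by rw [← grLin_eq]; exact h i
  rw [Submodule.mem_bot, hD, sub_eq_zero] at this
  exact this

theorem outerArgs_mem {m n : ℕ} (i : Fin (m + 1)) {a : Fin (m + n) → Lin M} {y : Lin M}
    {p : Fin (m + n) → ℤ} {c : ℤ} (ha : ∀ j, a j ∈ grLin M (p j)) (hy : y ∈ grLin M c) (j) :
    outerArgs i a y j ∈ grLin M (outerArgs i p c j) := by
  unfold outerArgs
  split_ifs
  · exact ha _
  · exact hy
  · exact ha _

theorem sum_outerArgs {m n : ℕ} (i : Fin (m + 1)) (p : Fin (m + n) → ℤ) :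
    ∑ j, outerArgs i p (∑ l, innerArgs i p l) j = ∑ j, p j := by
  obtain ⟨i, hi⟩ := i
  obtain ⟨c, rfl⟩ : ∃ c, m = i + c := ⟨m - i, by omega⟩
  let P : ℕ → ℤ := fun x => if h : x < i + c + n then p ⟨x, h⟩ else 0
  have hp : ∀ x : Fin (i + c + n), p x = P x := fun x => by simp [P]
  have h1 : ∑ j, p j = ∑ x ∈ Finset.range (i + n + c), P x := by
    rw [show i + n + c = i + c + n by omega, Finset.sum_range]
    exact Finset.sum_congr rfl fun j _ => hp j
  have h2 : ∑ l, innerArgs (m := i + c) ⟨i, hi⟩ p l = ∑ l ∈ Finset.range n, P (i + l) := by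
    rw [Finset.sum_range]
    exact Finset.sum_congr rfl fun j _ => hp _
  let Q : ℕ → ℤ := fun x => if x < i then P x else
    if x = i then ∑ l ∈ Finset.range n, P (i + l) else P (x - 1 + n)
  have h3 : ∀ j : Fin (i + c + 1), outerArgs (m := i + c) ⟨i, hi⟩ p
      (∑ l, innerArgs (m := i + c) ⟨i, hi⟩ p l) j = Q j := by
    intro j
    simp only [outerArgs, Q, ← h2, hp]
    split_ifs <;> rfl
  rw [Finset.sum_congr rfl fun j _ => h3 j, h1, ← Finset.sum_range (f := Q),
    show i + c + 1 = i + 1 + c by omega, Finset.sum_range_add, Finset.sum_range_succ,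
    Finset.sum_range_add, Finset.sum_range_add]
  congr 1
  · congr 1
    · exact Finset.sum_congr rfl fun x hx => by simp [Q, Finset.mem_range.1 hx]
    · simp [Q]
  · refine Finset.sum_congr rfl fun x _ => ?_
    have e1 : ¬ (i + 1 + x < i) := by omega
    have e2 : ¬ (i + 1 + x = i) := by omega
    simp only [Q, e1, e2, if_false]
    congr 1
    omega

theorem perm_mem {r q : ℕ} (s : Equiv.Perm (Fin r)) {e : BarrattEccles k r}
    (he : e ∈ BarrattEccles.gr k r q) : BarrattEccles.perm k s e ∈ BarrattEccles.gr k r q := by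
  rw [BarrattEccles.gr_eq_span] at he
  induction he using Submodule.span_induction with
  | mem e he =>
    obtain ⟨σ, rfl, rfl⟩ := he
    simp only [BarrattEccles.perm, Finsupp.linearCombination_single, one_smul]
    exact BarrattEccles.cls_mem _
  | zero => simp
  | add e f _ _ he hf => rw [map_add]; exact Submodule.add_mem _ he hf
  | smul c e _ he => rw [map_smul]; exact Submodule.smul_mem _ c he

theorem comp_mem {m n : ℕ} (i : Fin (m + 1)) (σ : BESimplex (m + 1)) (τ : BESimplex n) :
    BarrattEccles.comp k i (Finsupp.single σ 1) (Finsupp.single τ 1) ∈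
      BarrattEccles.gr k (m + n) (σ.dim + τ.dim) := by
  simp only [BarrattEccles.comp, Finsupp.linearCombination_single, one_smul]
  exact Submodule.sum_mem _ fun _ _ =>
    BarrattEccles.negOnePow_smul_mem _ _ (BarrattEccles.cls_mem _)

theorem single_mem_gr {r : ℕ} (σ : BESimplex r) :
    (Finsupp.single σ 1 : BarrattEccles k r) ∈ BarrattEccles.gr k r σ.dim :=
  Finsupp.single_mem_supported k _ rfl

theorem Rel.homogeneous {x : Lin M} (h : Rel M x) : ∃ n, x ∈ grLin M n := by
  induction h with
  | add p x y =>
    exact ⟨p, Submodule.sub_mem _ (Submodule.sub_mem _ (gen_mem _) (gen_mem _)) (gen_mem _)⟩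
  | smul p c x => exact ⟨p, Submodule.sub_mem _ (gen_mem _) (Submodule.smul_mem _ c (gen_mem _))⟩
  | perm s σ t =>
    refine ⟨_, Submodule.sub_mem _ (actLin_mem (perm_mem s (single_mem_gr σ))
      fun i => gen_mem (t i)) (BarrattEccles.negOnePow_smul_mem _ _ ?_)⟩
    have := op_mem σ fun i => gen_mem (t (s i))
    rwa [Equiv.sum_comp s fun i => (t i).deg] at this
  | one t =>
    refine ⟨(t 0).deg, Submodule.sub_mem _ ?_ (gen_mem _)⟩
    have := actLin_mem (BarrattEccles.cls_mem (k := k) (d := 0) fun _ => (1 : Equiv.Perm (Fin 1)))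
      fun i => gen_mem (t i)
    unfold BarrattEccles.one
    simpa using this
  | @comp m n i σ τ t =>
    refine ⟨_, Submodule.sub_mem _ (op_mem σ (outerArgs_mem i (fun j => gen_mem (t j))
      (op_mem τ (p := innerArgs i fun j => (t j).deg) fun j => gen_mem _)))
      (BarrattEccles.negOnePow_smul_mem _ _ ?_)⟩
    have := actLin_mem (comp_mem (k := k) i σ τ) fun j => gen_mem (t j)
    convert this using 2
    rw [← sum_outerArgs i fun j => (t j).deg]
    have e : ∀ (p : Fin (m + n) → ℤ) (c d : ℤ) (j), outerArgs i p (c + d) j =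
        outerArgs i p d j + if j = i then c else 0 := by
      intro p c d j
      unfold outerArgs
      by_cases h : j = i
      · subst h; simp [add_comm]
      · have : ¬ j.val = i.val := fun h' => h (Fin.ext h')
        simp [h, this]
    rw [Finset.sum_congr rfl fun j _ => e _ _ _ j, Finset.sum_add_distrib]
    simp
    ring
  | d_d t => exact ⟨_, dLin_mem (dLin_mem (gen_mem t))⟩
  | d x _ ih => obtain ⟨n, hn⟩ := ih; exact ⟨_, dLin_mem hn⟩
  | op σ t i x _ ih =>
    obtain ⟨n, hn⟩ := ih
    refine ⟨_, op_mem σ (p := Function.update (fun j => (t j).deg) i n) fun j => ?_⟩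
    by_cases hj : j = i
    · subst hj; simpa using hn
    · simpa [Function.update_of_ne hj] using gen_mem (t j)

theorem dLin_ideal {x : Lin M} (hx : x ∈ ideal M) : dLin M x ∈ ideal M := by
  refine (Submodule.span_le (p := (ideal M).comap (dLin M))).2 ?_ hx
  exact fun y hy => Submodule.subset_span (Rel.d y hy)

theorem op_ideal {r : ℕ} (σ : BESimplex r) (x : Fin r → Lin M) (i : Fin r)
    (hi : x i ∈ ideal M) : op σ x ∈ ideal M := by
  refine (op σ).mem_of_span _ (Function.update (fun _ => Set.range gen) i {x | Rel M x}) ?_ x ?_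
  · intro y hy
    have h1 : ∀ j, ∃ t : FreeTerm M, j ≠ i → gen t = y j := by
      intro j
      by_cases hj : j = i
      · exact ⟨of 0 0, fun h => absurd hj h⟩
      · have := hy j
        rw [Function.update_of_ne hj] at this
        obtain ⟨t, ht⟩ := this
        exact ⟨t, fun _ => ht⟩
    choose t ht using h1
    have h2 : y = Function.update (fun j => gen (t j)) i (y i) := by
      ext1 j
      by_cases hj : j = i
      · subst hj; simp
      · rw [Function.update_of_ne hj, ht j hj]
    rw [h2]
    have := hy i
    rw [Function.update_self] at this
    exact Submodule.subset_span (Rel.op σ t i _ this)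
  · intro j
    by_cases hj : j = i
    · subst hj; rw [Function.update_self]; exact hi
    · rw [Function.update_of_ne hj, span_gen]; trivial

theorem actLin_ideal {r : ℕ} (e : BarrattEccles k r) (x : Fin r → Lin M) (i : Fin r)
    (hi : x i ∈ ideal M) : actLin M r e x ∈ ideal M := by
  induction e using Finsupp.induction_linear with
  | zero => simp
  | add e f he hf => rw [map_add]; exact Submodule.add_mem _ he hf
  | single σ c =>
    rw [← mul_one c, ← smul_eq_mul, ← Finsupp.smul_single, map_smul, actLin_single]
    exact Submodule.smul_mem _ _ (op_ideal σ x i hi)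

theorem actLin_congr {r : ℕ} (e : BarrattEccles k r) (x y : Fin r → Lin M)
    (h : ∀ i, x i - y i ∈ ideal M) : actLin M r e x - actLin M r e y ∈ ideal M := by
  classical
  suffices H : ∀ s : Finset (Fin r), actLin M r e (s.piecewise x y) - actLin M r e y ∈ ideal M by
    simpa using H Finset.univ
  intro s
  induction s using Finset.induction_on with
  | empty => simp
  | insert a s ha ih =>
    rw [← sub_add_sub_cancel _ (actLin M r e (s.piecewise x y))]
    refine Submodule.add_mem _ ?_ ih
    have e1 : s.piecewise x y = Function.update (s.piecewise x y) a (y a) := by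
      rw [← Finset.piecewise_eq_of_notMem s x y ha, Function.update_eq_self]
    rw [Finset.piecewise_insert]
    nth_rewrite 2 [e1]
    rw [← MultilinearMap.map_update_sub]
    exact actLin_ideal e _ a (by simpa using h a)

/-- The projection onto the component of degree `n`. -/
noncomputable def proj (M : DGModule k) (n : ℤ) : Lin M →ₗ[k] Lin M :=
  Finsupp.linearCombination k fun t => if t.deg = n then gen t else 0

theorem proj_of_mem {n : ℤ} {x : Lin M} (hx : x ∈ grLin M n) : proj M n x = x := by
  rw [grLin_eq] at hx
  induction hx using Submodule.span_induction with
  | mem x h => obtain ⟨t, rfl, rfl⟩ := h; simp [proj]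
  | zero => simp
  | add x y _ _ h1 h2 => rw [map_add, h1, h2]
  | smul c x _ h1 => rw [map_smul, h1]

theorem proj_of_ne {m n : ℤ} (hmn : m ≠ n) {x : Lin M} (hx : x ∈ grLin M m) :
    proj M n x = 0 := by
  rw [grLin_eq] at hx
  induction hx using Submodule.span_induction with
  | mem x h => obtain ⟨t, rfl, rfl⟩ := h; simp [proj, hmn]
  | zero => simp
  | add x y _ _ h1 h2 => rw [map_add, h1, h2, add_zero]
  | smul c x _ h1 => rw [map_smul, h1, smul_zero]

theorem proj_ideal (n : ℤ) : ideal M ≤ (ideal M).comap (proj M n) := by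
  refine Submodule.span_le.2 fun x hx => ?_
  obtain ⟨m, hm⟩ := Rel.homogeneous hx
  change proj M n x ∈ ideal M
  by_cases h : m = n
  · subst h; rw [proj_of_mem hm]; exact Submodule.subset_span hx
  · rw [proj_of_ne h hm]; exact Submodule.zero_mem _

/-- The operations on the quotient by the relations. -/
noncomputable def actQuot (M : DGModule k) (r : ℕ) (e : BarrattEccles k r) :
    MultilinearMap k (fun _ : Fin r => Lin M ⧸ ideal M) (Lin M ⧸ ideal M) where
  toFun x := (ideal M).mkQ (actLin M r e fun i => (x i).out)
  map_update_add' := by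
    intro _ x i u v
    rw [← map_add, ← sub_eq_zero, ← map_sub]
    have h : ∀ w : Lin M ⧸ ideal M, (fun j => (Function.update x i w j).out) =
        Function.update (fun j => (x j).out) i w.out := by
      intro w; ext1 j
      by_cases hj : j = i
      · subst hj; simp
      · simp [Function.update_of_ne hj]
    rw [h, h, h]
    rw [← (actLin M r e).map_update_add, ← (actLin M r e).map_update_sub]
    refine (Submodule.Quotient.mk_eq_zero _).2 (actLin_ideal e _ i ?_)
    rw [Function.update_self, ← Submodule.Quotient.mk_eq_zero]
    simp [Submodule.Quotient.mk_out]
  map_update_smul' := by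
    intro _ x i c u
    rw [← map_smul, ← sub_eq_zero, ← map_sub]
    have h : ∀ w : Lin M ⧸ ideal M, (fun j => (Function.update x i w j).out) =
        Function.update (fun j => (x j).out) i w.out := by
      intro w; ext1 j
      by_cases hj : j = i
      · subst hj; simp
      · simp [Function.update_of_ne hj]
    rw [h, h, ← (actLin M r e).map_update_smul, ← (actLin M r e).map_update_sub]
    refine (Submodule.Quotient.mk_eq_zero _).2 (actLin_ideal e _ i ?_)
    rw [Function.update_self, ← Submodule.Quotient.mk_eq_zero]
    simp [Submodule.Quotient.mk_out]

theorem actQuot_mk {r : ℕ} (e : BarrattEccles k r) (x : Fin r → Lin M) :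
    actQuot M r e (fun i => (ideal M).mkQ (x i)) = (ideal M).mkQ (actLin M r e x) := by
  change (ideal M).mkQ (actLin M r e fun i => ((ideal M).mkQ (x i)).out) = _
  rw [← sub_eq_zero, ← map_sub]
  refine (Submodule.Quotient.mk_eq_zero _).2 (actLin_congr e _ _ fun i => ?_)
  rw [← Submodule.Quotient.mk_eq_zero]
  simp [Submodule.Quotient.mk_out]

theorem dLin_dLin_mem (x : Lin M) : dLin M (dLin M x) ∈ ideal M := by
  have hx : x ∈ Submodule.span k (Set.range (gen : FreeTerm M → Lin M)) := by
    rw [span_gen]; trivial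
  induction hx using Submodule.span_induction with
  | mem x h => obtain ⟨t, rfl⟩ := h; exact Submodule.subset_span (Rel.d_d t)
  | zero => simp
  | add x y _ _ h1 h2 => rw [map_add, map_add]; exact Submodule.add_mem _ h1 h2
  | smul c x _ h1 => rw [map_smul, map_smul]; exact Submodule.smul_mem _ c h1

/-- The dg-module underlying the free algebra. -/
noncomputable def freeDG (M : DGModule k) : DGModule k where
  carrier := Lin M ⧸ ideal M
  gr n := (grLin M n).map (ideal M).mkQ
  isInternal := by
    refine DGModule.isInternal_of_proj _
      (fun n => Submodule.mapQ _ _ (proj M n) (proj_ideal n)) ?_ ?_ ?_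
    · rintro n _ ⟨x, hx, rfl⟩
      exact congrArg _ (proj_of_mem hx)
    · rintro m n hmn _ ⟨x, hx, rfl⟩
      change (ideal M).mkQ (proj M n x) = 0
      rw [proj_of_ne hmn hx, map_zero]
    · rw [← Submodule.map_iSup, eq_top_iff, ← Submodule.range_mkQ (ideal M), LinearMap.range_eq_map,
        ← span_gen]
      refine Submodule.map_mono (Submodule.span_le.2 ?_)
      rintro _ ⟨t, rfl⟩
      exact Submodule.mem_iSup_of_mem t.deg (gen_mem t)
  d := Submodule.mapQ _ _ (dLin M) fun _ hx => dLin_ideal hx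
  d_mem := by
    rintro n _ ⟨x, hx, rfl⟩
    exact ⟨_, dLin_mem hx, rfl⟩
  d_d := by
    intro x
    obtain ⟨x, rfl⟩ := (ideal M).mkQ_surjective x
    exact (Submodule.Quotient.mk_eq_zero _).2 (dLin_dLin_mem x)

/-- The class of a linear combination of expressions in the free algebra. -/
noncomputable def toFree (M : DGModule k) : Lin M →ₗ[k] freeDG M := (ideal M).mkQ

theorem freeDG_d (x : Lin M) : (freeDG M).d (toFree M x) = toFree M (dLin M x) := rfl

theorem toFree_surjective : Function.Surjective (toFree M) := (ideal M).mkQ_surjective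

theorem toFree_mem {n : ℤ} {x : Lin M} (hx : x ∈ grLin M n) : toFree M x ∈ (freeDG M).gr n :=
  ⟨x, hx, rfl⟩

theorem toFree_eq {x y : Lin M} (h : x - y ∈ ideal M) : toFree M x = toFree M y := by
  rw [← sub_eq_zero, ← map_sub]
  exact (Submodule.Quotient.mk_eq_zero _).2 h

theorem toFree_sign (n : ℤ) (x : Lin M) :
    toFree M (n.negOnePow • x) = n.negOnePow • toFree M x := by
  rw [Units.smul_def, Units.smul_def, map_zsmul]

theorem exists_lift_fun {r : ℕ} (a : Fin r → freeDG M) :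
    ∃ x : Fin r → Lin M, a = fun i => toFree M (x i) := by
  choose x hx using fun i => toFree_surjective (a i)
  exact ⟨x, funext fun i => (hx i).symm⟩

theorem exists_lift {r : ℕ} {a : Fin r → freeDG M} {p : Fin r → ℤ}
    (h : ∀ i, a i ∈ (freeDG M).gr (p i)) :
    ∃ x : Fin r → Lin M, (∀ i, x i ∈ grLin M (p i)) ∧ a = fun i => toFree M (x i) := by
  choose x hx hxa using h
  exact ⟨x, hx, funext fun i => (hxa i).symm⟩

theorem dLin_actLin {r q : ℕ} {e : BarrattEccles k r} (he : e ∈ BarrattEccles.gr k r q)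
    {x : Fin r → Lin M} {p : Fin r → ℤ} (h : ∀ i, x i ∈ grLin M (p i)) :
    dLin M (actLin M r e x) = actLin M r (BarrattEccles.d k r e) x +
      ∑ i, (q + ∑ j with j < i, p j).negOnePow •
        actLin M r e (Function.update x i (dLin M (x i))) := by
  rw [BarrattEccles.gr_eq_span] at he
  induction he using Submodule.span_induction with
  | mem e he => obtain ⟨σ, rfl, rfl⟩ := he; simp only [actLin_single]; exact dLin_op σ h
  | zero => simp
  | add e f _ _ he hf =>
    simp only [map_add, add_apply, he, hf, smul_add, Finset.sum_add_distrib]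
    abel
  | smul c e _ he =>
    simp only [map_smul, smul_apply, he, smul_add, Finset.smul_sum]
    congr 1
    exact Finset.sum_congr rfl fun i _ => (smul_comm _ _ _)

theorem actLin_perm {r : ℕ} (s : Equiv.Perm (Fin r)) (e : BarrattEccles k r)
    {x : Fin r → Lin M} {p : Fin r → ℤ} (h : ∀ i, x i ∈ grLin M (p i)) :
    actLin M r (BarrattEccles.perm k s e) x -
      (koszulExp s p).negOnePow • actLin M r e (fun i => x (s i)) ∈ ideal M := by
  induction e using Finsupp.induction_linear with
  | zero => simp
  | add e f he hf =>
    have := Submodule.add_mem _ he hf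
    simp only [map_add, add_apply, smul_add]
    convert this using 1
    abel
  | single σ c =>
    rw [← mul_one c, ← smul_eq_mul, ← Finsupp.smul_single]
    simp only [map_smul, smul_apply]
    rw [smul_comm _ c, ← smul_sub]
    refine Submodule.smul_mem _ c ?_
    rw [actLin_single]
    have := (actLin M r (BarrattEccles.perm k s (Finsupp.single σ 1)) -
      (koszulExp s p).negOnePow • (op σ).domDomCongr s).mem_of_span (ideal M)
        (fun i => gen '' {t | t.deg = p i}) (fun y hy => by
          choose t ht hty using hy
          obtain rfl : (fun i => gen (t i)) = y := funext hty
          obtain rfl : (fun i => (t i).deg) = p := funext ht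
          exact Submodule.subset_span (Rel.perm s σ t)) x fun i => by rw [← grLin_eq]; exact h i
    exact this

theorem args_update {V : Type*} {m n : ℕ} (i : Fin (m + 1)) (a : Fin (m + n) → V)
    (x : Fin (m + n)) :
    (∃ l : Fin n, ∀ u, innerArgs i (Function.update a x u) = Function.update (innerArgs i a) l u ∧
      ∀ y, outerArgs i (Function.update a x u) y = outerArgs i a y) ∨
    (∃ j : Fin (m + 1), ∀ u, innerArgs i (Function.update a x u) = innerArgs i a ∧
      ∀ y, outerArgs i (Function.update a x u) y = Function.update (outerArgs i a y) j u) := by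
  by_cases hx : i.val ≤ x.val ∧ x.val < i.val + n
  · refine Or.inl ⟨⟨x.val - i.val, by omega⟩, fun u => ⟨?_, fun y => ?_⟩⟩
    · ext1 l
      simp only [innerArgs, Function.update_apply, Fin.ext_iff]
      congr 1
      exact propext ⟨fun h => by omega, fun h => by omega⟩
    · ext1 j
      have hj := j.2
      simp only [outerArgs, Function.update_apply, Fin.ext_iff]
      split_ifs <;> first | rfl | omega
  · refine Or.inr ?_
    by_cases h1 : x.val < i.val
    · refine ⟨⟨x.val, by omega⟩, fun u => ⟨?_, fun y => ?_⟩⟩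
      · ext1 l
        simp only [innerArgs, Function.update_apply, Fin.ext_iff]
        rw [if_neg (by omega)]
      · ext1 j
        simp only [outerArgs, Function.update_apply, Fin.ext_iff]
        split_ifs <;> first | rfl | omega
    · refine ⟨⟨x.val + 1 - n, by omega⟩, fun u => ⟨?_, fun y => ?_⟩⟩
      · ext1 l
        have hl := l.2
        simp only [innerArgs, Function.update_apply, Fin.ext_iff]
        rw [if_neg (by omega)]
      · ext1 j
        simp only [outerArgs, Function.update_apply, Fin.ext_iff]
        split_ifs <;> first | rfl | omega

theorem outerArgs_eq {V : Type*} {m n : ℕ} (i : Fin (m + 1)) (a : Fin (m + n) → V) (y y' : V) :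
    outerArgs i a y = Function.update (outerArgs i a y') i y := by
  ext1 j
  simp only [outerArgs, Function.update_apply, Fin.ext_iff]
  split_ifs <;> first | rfl | omega

/-- The two-level composite of two multilinear maps. -/
noncomputable def compMulti {V : Type*} [AddCommGroup V] [Module k V] {m n : ℕ} (i : Fin (m + 1))
    (f : MultilinearMap k (fun _ : Fin (m + 1) => V) V)
    (g : MultilinearMap k (fun _ : Fin n => V) V) :
    MultilinearMap k (fun _ : Fin (m + n) => V) V where
  toFun a := f (outerArgs i a (g (innerArgs i a)))
  map_update_add' := by
    intro inst a x u v
    obtain rfl : inst = instDecidableEqFin _ := Subsingleton.elim _ _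
    rcases args_update i a x with ⟨l, h⟩ | ⟨j, h⟩
    · simp only [(h _).1, (h _).2, g.map_update_add]
      rw [outerArgs_eq i a _ 0, f.map_update_add, ← outerArgs_eq, ← outerArgs_eq]
    · simp only [(h _).1, (h _).2, f.map_update_add]
  map_update_smul' := by
    intro inst a x c u
    obtain rfl : inst = instDecidableEqFin _ := Subsingleton.elim _ _
    rcases args_update i a x with ⟨l, h⟩ | ⟨j, h⟩
    · simp only [(h _).1, (h _).2, g.map_update_smul]
      rw [outerArgs_eq i a _ 0, f.map_update_smul, ← outerArgs_eq]
    · simp only [(h _).1, (h _).2, f.map_update_smul]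

theorem actLin_comp {m n q : ℕ} (i : Fin (m + 1)) (e : BarrattEccles k (m + 1))
    {f : BarrattEccles k n} {a : Fin (m + n) → Lin M} {p : Fin (m + n) → ℤ}
    (hf : f ∈ BarrattEccles.gr k n q) (h : ∀ j, a j ∈ grLin M (p j)) :
    actLin M (m + 1) e (outerArgs i a (actLin M n f (innerArgs i a))) -
      (q * ∑ j with j.val < i.val, p j).negOnePow •
        actLin M (m + n) (BarrattEccles.comp k i e f) a ∈ ideal M := by
  rw [BarrattEccles.gr_eq_span] at hf
  induction hf using Submodule.span_induction with
  | mem f hf =>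
    obtain ⟨τ, rfl, rfl⟩ := hf
    induction e using Finsupp.induction_linear with
    | zero => simp
    | add e f he hf =>
      have := Submodule.add_mem _ he hf
      simp only [map_add, add_apply, LinearMap.add_apply, smul_add]
      convert this using 1
      abel
    | single σ c =>
      rw [← mul_one c, ← smul_eq_mul, ← Finsupp.smul_single]
      simp only [map_smul, smul_apply, LinearMap.smul_apply]
      rw [smul_comm _ c, ← smul_sub]
      refine Submodule.smul_mem _ c ?_
      rw [actLin_single, actLin_single]
      exact (compMulti i (op σ) (op τ) -
        ((τ.dim : ℤ) * ∑ j ∈ Finset.univ.filter (fun j : Fin (m + n) => j.val < i.val),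
          p j).negOnePow • actLin M (m + n)
          (BarrattEccles.comp k i (Finsupp.single σ 1) (Finsupp.single τ 1))).mem_of_span
          (ideal M) (fun i => gen '' {t | t.deg = p i}) (fun y hy => by
            choose t ht hty using hy
            obtain rfl : (fun i => gen (t i)) = y := funext hty
            obtain rfl : (fun i => (t i).deg) = p := funext ht
            exact Submodule.subset_span (Rel.comp i σ τ t)) a
          fun i => by rw [← grLin_eq]; exact h i
  | zero =>
    rw [outerArgs_eq i a _ 0]
    simp
  | add f f' _ _ hf hf' =>
    rw [outerArgs_eq i a _ 0] at hf hf' ⊢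
    have := Submodule.add_mem _ hf hf'
    simp only [map_add, add_apply, smul_add, MultilinearMap.map_update_add]
    convert this using 1
    abel
  | smul c f _ hf =>
    rw [outerArgs_eq i a _ 0] at hf ⊢
    simp only [map_smul, smul_apply, MultilinearMap.map_update_smul]
    rw [smul_comm _ c, ← smul_sub]
    exact Submodule.smul_mem _ c hf

theorem actLin_one (x : Fin 1 → Lin M) :
    actLin M 1 (BarrattEccles.one k) x - x 0 ∈ ideal M := by
  refine (actLin M 1 (BarrattEccles.one k) - MultilinearMap.ofSubsingleton k (Lin M) (Lin M)
    (0 : Fin 1) LinearMap.id).mem_of_span (ideal M) (fun _ => Set.range gen) (fun y hy => ?_) x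
      fun i => by rw [span_gen]; trivial
  choose t hty using hy
  obtain rfl : (fun i => gen (t i)) = y := funext hty
  exact Submodule.subset_span (Rel.one t)

theorem toFree_outerArgs {m n : ℕ} (i : Fin (m + 1)) (a : Fin (m + n) → Lin M) (y : Lin M) :
    outerArgs i (fun j => toFree M (a j)) (toFree M y) =
      fun j => toFree M (outerArgs i a y j) := by
  ext1 j
  simp only [outerArgs]
  split_ifs <;> rfl

theorem toFree_innerArgs {m n : ℕ} (i : Fin (m + 1)) (a : Fin (m + n) → Lin M) :
    innerArgs i (fun j => toFree M (a j)) = fun l => toFree M (innerArgs i a l) := rfl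

theorem toFree_update {r : ℕ} (a : Fin r → Lin M) (i : Fin r) (y : Lin M) :
    Function.update (fun j => toFree M (a j)) i (toFree M y) =
      fun j => toFree M (Function.update a i y j) := by
  ext1 j
  by_cases hj : j = i
  · subst hj; simp
  · simp [Function.update_of_ne hj]

/-- The operations on the free algebra, linear in the element of the operad. -/
noncomputable def actFree (M : DGModule k) (r : ℕ) :
    BarrattEccles k r →ₗ[k] MultilinearMap k (fun _ : Fin r => freeDG M) (freeDG M) where
  toFun := actQuot M r
  map_add' e f := MultilinearMap.ext fun x => by
    obtain ⟨x, rfl⟩ := exists_lift_fun x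
    refine (actQuot_mk (e + f) x).trans ?_
    rw [map_add]
    exact ((congrArg₂ (· + ·) (actQuot_mk e x) (actQuot_mk f x)).trans
      ((toFree M).map_add _ _).symm).symm
  map_smul' c e := MultilinearMap.ext fun x => by
    obtain ⟨x, rfl⟩ := exists_lift_fun x
    refine (actQuot_mk (c • e) x).trans ?_
    rw [map_smul]
    exact ((congrArg (c • ·) (actQuot_mk e x)).trans ((toFree M).map_smul c _).symm).symm

theorem actFree_mk {r : ℕ} (e : BarrattEccles k r) (x : Fin r → Lin M) :
    actFree M r e (fun i => toFree M (x i)) = toFree M (actLin M r e x) :=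
  actQuot_mk e x

end FreeTerm

namespace BEAlgebra

open FreeTerm

variable {k : Type u} [Field k]

/-- The free algebra `S(M)` over the Barratt-Eccles operad. -/
noncomputable def freeObj (M : DGModule k) : BEAlgebra k where
  dg := freeDG M
  act := actFree M
  act_mem := by
    intro r q e a p he ha
    obtain ⟨x, hx, rfl⟩ := exists_lift ha
    rw [actFree_mk]
    exact toFree_mem (actLin_mem he hx)
  d_act := by
    intro r q e a p he ha
    obtain ⟨x, hx, rfl⟩ := exists_lift ha
    simp only [actFree_mk, freeDG_d]
    rw [dLin_actLin he hx, map_add, map_sum]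
    congr 1
    refine Finset.sum_congr rfl fun i _ => ?_
    rw [toFree_sign, ← actFree_mk]
    exact congrArg _ (congrArg _ (toFree_update x i _).symm)
  act_perm := by
    intro r s e a p ha
    obtain ⟨x, hx, rfl⟩ := exists_lift ha
    rw [actFree_mk, actFree_mk e fun i => x (s i), ← toFree_sign]
    exact toFree_eq (actLin_perm s e hx)
  act_one := by
    intro a
    obtain ⟨x, rfl⟩ := exists_lift_fun a
    rw [actFree_mk]
    exact toFree_eq (actLin_one x)
  act_comp := by
    intro m n q i e f a p hf ha
    obtain ⟨x, hx, rfl⟩ := exists_lift ha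
    rw [toFree_innerArgs, actFree_mk f, toFree_outerArgs, actFree_mk, actFree_mk, ← toFree_sign]
    exact toFree_eq (actLin_comp i e hf hx)

/-- The canonical embedding of `M` in the free algebra, in each degree. -/
noncomputable def unitGr (M : DGModule k) (p : ℤ) : M.gr p →ₗ[k] freeDG M where
  toFun x := toFree M (gen (of p x))
  map_add' x y := by
    rw [← map_add]
    refine toFree_eq ?_
    rw [← sub_sub]
    exact Submodule.subset_span (Rel.add p x y)
  map_smul' c x := by
    rw [RingHom.id_apply, ← map_smul]
    exact toFree_eq (Submodule.subset_span (Rel.smul p c x))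

/-- A linear map from a dg-module is determined by linear maps on its components. -/
noncomputable def ofGr (M : DGModule k) {V : Type*} [AddCommGroup V] [Module k V]
    (f : ∀ p, M.gr p →ₗ[k] V) : M →ₗ[k] V :=
  DirectSum.toModule k ℤ V f ∘ₗ
    (LinearEquiv.ofBijective (DirectSum.coeLinearMap M.gr) M.isInternal).symm.toLinearMap

theorem ofGr_apply (M : DGModule k) {V : Type*} [AddCommGroup V] [Module k V]
    (f : ∀ p, M.gr p →ₗ[k] V) {p : ℤ} (x : M.gr p) : ofGr M f x = f p x := by
  have : (LinearEquiv.ofBijective (DirectSum.coeLinearMap M.gr) M.isInternal).symm x.1 =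
      DirectSum.lof k ℤ (fun p => M.gr p) p x := by
    rw [LinearEquiv.symm_apply_eq]
    exact (DirectSum.coeLinearMap_lof M.gr p x).symm
  simp [ofGr, this]

theorem ext_gr {M : DGModule k} {V : Type*} [AddCommGroup V] [Module k V] {f g : M →ₗ[k] V}
    (h : ∀ p, ∀ x ∈ M.gr p, f x = g x) : f = g := by
  rw [← LinearMap.eqLocus_eq_top, eq_top_iff, ← M.iSup_gr]
  exact iSup_le fun p x hx => h p x hx

/-- The canonical embedding of `M` in the free algebra. -/
noncomputable def unitHom (M : DGModule k) : M ⟶ freeDG M :=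
  DGModule.Hom.mk (ofGr M (unitGr M))
    (fun {n x} hx => by
      rw [ofGr_apply M (unitGr M) ⟨x, hx⟩]
      exact toFree_mem (gen_mem (of n ⟨x, hx⟩)))
    (fun x => by
      refine LinearMap.congr_fun (f := ofGr M (unitGr M) ∘ₗ M.d)
        (g := (freeDG M).d ∘ₗ ofGr M (unitGr M)) (ext_gr fun p x hx => ?_) x
      rw [LinearMap.comp_apply, LinearMap.comp_apply, ofGr_apply M (unitGr M) ⟨x, hx⟩,
        ofGr_apply M (unitGr M) ⟨M.d x, M.d_mem hx⟩]
      change _ = (freeDG M).d (toFree M (gen (of p ⟨x, hx⟩)))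
      rw [freeDG_d, dLin_gen]
      rfl)

theorem unitHom_apply {M : DGModule k} {p : ℤ} (x : M.gr p) :
    (unitHom M).lin x = toFree M (gen (of p x)) := ofGr_apply M (unitGr M) x

variable {M : DGModule k} {B : BEAlgebra k}

/-- The evaluation of an expression in an algebra. -/
noncomputable def interp (f : M ⟶ B.dg) : FreeTerm M → B.dg
  | of _ x => f.lin x
  | node (r := r) σ t => B.act r (Finsupp.single σ 1) fun i => interp f (t i)

/-- The evaluation of linear combinations of expressions. -/
noncomputable def interpLin (f : M ⟶ B.dg) : Lin M →ₗ[k] B.dg :=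
  Finsupp.linearCombination k (interp f)

theorem interpLin_gen (f : M ⟶ B.dg) (t : FreeTerm M) : interpLin f (gen t) = interp f t := by
  simp [interpLin]

theorem interp_mem (f : M ⟶ B.dg) (t : FreeTerm M) : interp f t ∈ B.dg.gr t.deg := by
  induction t with
  | of p x => exact f.map_gr x.2
  | node σ t ih => exact B.act_mem (single_mem_gr σ) ih

theorem interpLin_op (f : M ⟶ B.dg) {r : ℕ} (σ : BESimplex r) (x : Fin r → Lin M) :
    interpLin f (op σ x) = B.act r (Finsupp.single σ 1) fun i => interpLin f (x i) := by
  have := ((interpLin f).compMultilinearMap (op σ) -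
    (B.act r (Finsupp.single σ 1)).compLinearMap fun _ => interpLin f).mem_of_span ⊥
      (fun _ => Set.range gen) (fun y hy => by
        choose t hty using hy
        obtain rfl : (fun i => gen (t i)) = y := funext hty
        rw [Submodule.mem_bot, sub_apply, LinearMap.compMultilinearMap_apply,
          MultilinearMap.compLinearMap_apply, op_gen, interpLin_gen, interp, sub_eq_zero]
        simp only [interpLin_gen]) x fun i => by rw [span_gen]; trivial
  rwa [Submodule.mem_bot, sub_apply, sub_eq_zero] at this

theorem interpLin_actLin (f : M ⟶ B.dg) {r : ℕ} (e : BarrattEccles k r) (x : Fin r → Lin M) :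
    interpLin f (actLin M r e x) = B.act r e fun i => interpLin f (x i) := by
  induction e using Finsupp.induction_linear with
  | zero => simp
  | add e e' h h' => simp only [map_add, add_apply, h, h']
  | single σ c =>
    rw [← mul_one c, ← smul_eq_mul, ← Finsupp.smul_single]
    simp only [map_smul, smul_apply, actLin_single, interpLin_op]

theorem interpLin_update (f : M ⟶ B.dg) {r : ℕ} (x : Fin r → Lin M) (i : Fin r) (y : Lin M) :
    (fun j => interpLin f (Function.update x i y j)) =
      Function.update (fun j => interpLin f (x j)) i (interpLin f y) := by
  ext1 j
  by_cases hj : j = i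
  · subst hj; simp
  · simp [Function.update_of_ne hj]

theorem interpLin_dTerm (f : M ⟶ B.dg) (t : FreeTerm M) :
    interpLin f (dTerm t) = B.dg.d (interp f t) := by
  induction t with
  | of p x => rw [dTerm, interpLin_gen]; exact f.map_d x
  | node σ t ih =>
    rw [dTerm, interp, B.d_act (single_mem_gr σ) fun i => interp_mem f (t i), map_add,
      map_sum, interpLin_actLin]
    simp only [interpLin_gen]
    congr 1
    refine Finset.sum_congr rfl fun i _ => ?_
    rw [Units.smul_def, Units.smul_def, map_zsmul, interpLin_op, interpLin_update, ih]
    simp only [interpLin_gen]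

theorem interpLin_dLin (f : M ⟶ B.dg) (x : Lin M) :
    interpLin f (dLin M x) = B.dg.d (interpLin f x) := by
  induction x using Finsupp.induction_linear with
  | zero => simp
  | add x y hx hy => simp only [map_add, hx, hy]
  | single t c =>
    rw [← mul_one c, ← smul_eq_mul, ← Finsupp.smul_single]
    simp only [map_smul, dLin_gen, interpLin_gen, interpLin_dTerm]

theorem interpLin_outerArgs (f : M ⟶ B.dg) {m n : ℕ} (i : Fin (m + 1)) (a : Fin (m + n) → Lin M)
    (y : Lin M) : (fun j => interpLin f (outerArgs i a y j)) =
      outerArgs i (fun j => interpLin f (a j)) (interpLin f y) := by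
  ext1 j
  simp only [outerArgs]
  split_ifs <;> rfl

theorem interpLin_innerArgs (f : M ⟶ B.dg) {m n : ℕ} (i : Fin (m + 1))
    (a : Fin (m + n) → Lin M) : (fun l => interpLin f (innerArgs i a l)) =
      innerArgs i fun j => interpLin f (a j) := rfl

theorem interpLin_sign (f : M ⟶ B.dg) (n : ℤ) (x : Lin M) :
    interpLin f (n.negOnePow • x) = n.negOnePow • interpLin f x := by
  rw [Units.smul_def, Units.smul_def, map_zsmul]

theorem interpLin_rel (f : M ⟶ B.dg) {x : Lin M} (h : Rel M x) : interpLin f x = 0 := by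
  induction h with
  | add p x y => simp only [map_sub, interpLin_gen, interp, Submodule.coe_add, map_add]; abel
  | smul p c x => simp only [map_sub, map_smul, interpLin_gen, interp, Submodule.coe_smul, sub_self]
  | perm s σ t =>
    rw [map_sub, interpLin_sign, interpLin_actLin, interpLin_op, sub_eq_zero]
    simp only [interpLin_gen]
    exact B.act_perm s _ fun i => interp_mem f (t i)
  | one t =>
    rw [map_sub, interpLin_actLin, B.act_one, sub_self]
  | comp i σ τ t =>
    rw [map_sub, interpLin_sign, interpLin_actLin, interpLin_op, interpLin_outerArgs, interpLin_op,
      sub_eq_zero, interpLin_innerArgs]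
    simp only [interpLin_gen]
    exact B.act_comp i _ (single_mem_gr τ) fun i => interp_mem f (t i)
  | d_d t => rw [interpLin_dLin, interpLin_dLin, B.dg.d_d]
  | d x _ ih => rw [interpLin_dLin, ih, map_zero]
  | op σ t i x _ ih =>
    rw [interpLin_op, interpLin_update, ih, MultilinearMap.map_update_zero]

theorem interpLin_ideal (f : M ⟶ B.dg) : ideal M ≤ LinearMap.ker (interpLin f) :=
  Submodule.span_le.2 fun _ hx => interpLin_rel f hx

theorem interpLin_mem (f : M ⟶ B.dg) {n : ℤ} {x : Lin M} (hx : x ∈ grLin M n) :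
    interpLin f x ∈ B.dg.gr n := by
  rw [grLin_eq] at hx
  induction hx using Submodule.span_induction with
  | mem x h => obtain ⟨t, rfl, rfl⟩ := h; rw [interpLin_gen]; exact interp_mem f t
  | zero => simp
  | add x y _ _ h1 h2 => rw [map_add]; exact Submodule.add_mem _ h1 h2
  | smul c x _ h1 => rw [map_smul]; exact Submodule.smul_mem _ c h1

/-- The morphism from the free algebra induced by a morphism of dg-modules. -/
noncomputable def lift (f : M ⟶ B.dg) : freeObj M ⟶ B :=
  Hom.mk
    (DGModule.Hom.mk ((ideal M).liftQ (interpLin f) (interpLin_ideal f))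
      (by rintro n _ ⟨x, hx, rfl⟩; exact interpLin_mem f hx)
      (by
        intro x
        obtain ⟨x, rfl⟩ := toFree_surjective x
        exact interpLin_dLin f x))
    (by
      intro r e a
      obtain ⟨x, rfl⟩ := exists_lift_fun a
      exact (congrArg _ (actFree_mk e x)).trans (interpLin_actLin f e x))

theorem lift_gen (f : M ⟶ B.dg) (t : FreeTerm M) :
    (lift f).dgHom.lin (toFree M (gen t)) = interp f t := interpLin_gen f t

theorem free_hom_gen (g : freeObj M ⟶ B) (t : FreeTerm M) :
    g.dgHom.lin (toFree M (gen t)) = interp (unitHom M ≫ g.dgHom) t := by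
  induction t with
  | of p x =>
    rw [interp]
    exact (congrArg g.dgHom.lin (unitHom_apply x)).symm
  | @node r σ t ih =>
    rw [interp, ← funext ih, ← op_gen, ← actLin_single, ← actFree_mk]
    exact g.map_act _ _

/-- The universal property of the free algebra. -/
noncomputable def freeEquiv (M : DGModule k) (B : BEAlgebra k) :
    (freeObj M ⟶ B) ≃ (M ⟶ (forget k).obj B) where
  toFun g := unitHom M ≫ g.dgHom
  invFun f := lift f
  left_inv g := by
    refine hom_ext (DGModule.hom_ext fun x => ?_)
    refine LinearMap.congr_fun (f := (lift (unitHom M ≫ g.dgHom)).dgHom.lin)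
      (g := g.dgHom.lin) ?_ x
    refine (ideal M).linearMap_qext (Finsupp.lhom_ext' fun t => LinearMap.ext_ring ?_)
    exact (lift_gen _ t).trans (free_hom_gen g t).symm
  right_inv f := by
    refine DGModule.hom_ext fun x => ?_
    refine LinearMap.congr_fun (f := (unitHom M ≫ (lift f).dgHom).lin) (g := f.lin)
      (ext_gr fun p x hx => ?_) x
    change (lift f).dgHom.lin ((unitHom M).lin x) = f.lin x
    rw [unitHom_apply ⟨x, hx⟩]
    exact lift_gen (B := B) f _

theorem freeEquiv_naturality (M : DGModule k) (B B' : BEAlgebra k) (g : B ⟶ B')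
    (h : freeObj M ⟶ B) :
    freeEquiv M B' (h ≫ g) = freeEquiv M B h ≫ (forget k).map g := rfl

/-- The free algebra functor `S`. -/
noncomputable def free (k : Type u) [Field k] : DGModule k ⥤ BEAlgebra k :=
  Adjunction.leftAdjointOfEquiv freeEquiv freeEquiv_naturality

/-- The free algebra functor is left adjoint to the forgetful functor. -/
noncomputable def adj (k : Type u) [Field k] : free k ⊣ forget k :=
  Adjunction.adjunctionOfEquivLeft freeEquiv freeEquiv_naturality

end BEAlgebra

/-! ## The simplicial resolution associated to a comonad -/

namespace CotripleResolution

variable {C : Type*} [Category C] (G : Comonad C) (X : C)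

/-- The iterated composite `G ∘ ⋯ ∘ G (X)`, with `n` factors. -/
def iter : ℕ → C
  | 0 => X
  | n + 1 => G.obj (iter n)

/-- The map `i ↦ f (i + 1)`. -/
def tail {m n : ℕ} (f : Fin (m + 1) →o Fin n) : Fin m →o Fin n :=
  f.comp (Fin.succOrderEmb m).toOrderHom

/-- The map `i ↦ f i - 1`, when `f` does not reach `0`. -/
def pred {m n : ℕ} (f : Fin (m + 1) →o Fin (n + 1)) (h : f 0 ≠ 0) : Fin (m + 1) →o Fin n where
  toFun i := (f i).pred fun hi => h (le_antisymm (hi ▸ f.monotone (Fin.zero_le i)) (Fin.zero_le _))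
  monotone' _ _ hij := Fin.pred_le_pred_iff.2 (f.monotone hij)

/-- The morphism `G^n X ⟶ G^m X` associated to a nondecreasing map `f : {0 < ⋯ < m-1} → {0 < ⋯ <
n-1}`: the factors of the source that are not in the image of `f` are removed by the counit, and
the factors in the image are repeated by means of the comultiplication. -/
def map : ∀ (n m : ℕ) (_ : Fin m →o Fin n), iter G X n ⟶ iter G X m
  | 0, 0, _ => 𝟙 _
  | 0, _ + 1, f => (f 0).elim0
  | n + 1, 0, _ => G.ε.app (iter G X n) ≫ map n 0 ⟨Fin.elim0, fun i => i.elim0⟩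
  | n + 1, m + 1, f =>
    if h : f 0 = 0 then G.δ.app (iter G X n) ≫ G.map (map (n + 1) m (tail f))
    else G.ε.app (iter G X n) ≫ map n (m + 1) (pred f h)
termination_by n m => n + m

theorem map_zero_zero (f : Fin 0 →o Fin 0) : map G X 0 0 f = 𝟙 _ := by rw [map]

theorem map_succ_zero (n : ℕ) (f : Fin 0 →o Fin (n + 1)) (g : Fin 0 →o Fin n) :
    map G X (n + 1) 0 f = G.ε.app (iter G X n) ≫ map G X n 0 g := by
  rw [map]
  congr 2
  exact OrderHom.ext _ _ (funext fun i => i.elim0)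

theorem map_of_eq {n m : ℕ} (f : Fin (m + 1) →o Fin (n + 1)) (h : f 0 = 0) :
    map G X (n + 1) (m + 1) f =
      G.δ.app (iter G X n) ≫ G.map (map G X (n + 1) m (tail f)) := by
  rw [map, dif_pos h]
  rfl

theorem map_of_ne {n m : ℕ} (f : Fin (m + 1) →o Fin (n + 1)) (g : Fin (m + 1) →o Fin n)
    (h : ∀ i, f i = (g i).succ) :
    map G X (n + 1) (m + 1) f = G.ε.app (iter G X n) ≫ map G X n (m + 1) g := by
  have h0 : f 0 ≠ 0 := by rw [h]; exact Fin.succ_ne_zero _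
  rw [map, dif_neg h0]
  congr 2
  ext i
  simp [pred, h]

theorem map_eps {n m : ℕ} (f : Fin m →o Fin (n + 1)) (g : Fin m →o Fin n)
    (h : ∀ i, f i = (g i).succ) :
    map G X (n + 1) m f = G.ε.app (iter G X n) ≫ map G X n m g := by
  cases m with
  | zero => exact map_succ_zero G X n f g
  | succ m => exact map_of_ne G X f g h

/-- A map that preserves `0` and does not reach `0` elsewhere acts on the inner factors. -/
theorem map_inner {n m : ℕ} (f : Fin (m + 1) →o Fin (n + 1)) (g : Fin m →o Fin n)
    (h0 : f 0 = 0) (h : ∀ i, f i.succ = (g i).succ) :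
    map G X (n + 1) (m + 1) f = G.map (map G X n m g) := by
  rw [map_of_eq G X f h0, map_eps G X (tail f) g h, Functor.map_comp]
  exact G.right_counit_assoc _ _

theorem map_id (n : ℕ) : map G X n n OrderHom.id = 𝟙 _ := by
  induction n with
  | zero => exact map_zero_zero G X _
  | succ n ih =>
    rw [map_inner G X OrderHom.id OrderHom.id rfl fun _ => rfl, ih]
    exact G.map_id _

theorem map_comp_aux₁ {Y Z W : C} (a : G.obj Y ⟶ Z) (b : Z ⟶ W) :
    (G.δ.app Y ≫ G.map a) ≫ G.ε.app Z ≫ b = a ≫ b := by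
  rw [Category.assoc, G.counit_naturality_assoc, G.left_counit_assoc]

theorem map_comp_aux₂ {Y Z W : C} (a : G.obj Y ⟶ Z) (b : G.obj Z ⟶ W) :
    (G.δ.app Y ≫ G.map a) ≫ G.δ.app Z ≫ G.map b =
      G.δ.app Y ≫ G.map ((G.δ.app Y ≫ G.map a) ≫ b) := by
  rw [Category.assoc, G.delta_naturality_assoc, G.map_comp, G.map_comp, Category.assoc,
    G.coassoc_assoc]

theorem eq_succ_pred {m n : ℕ} (f : Fin (m + 1) →o Fin (n + 1)) (h : f 0 ≠ 0) (i) :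
    f i = (pred f h i).succ := by
  exact (Fin.succ_pred (f i) fun hi =>
    h (le_antisymm (hi ▸ f.monotone (Fin.zero_le i)) (Fin.zero_le _))).symm

theorem map_comp (N : ℕ) : ∀ {l m n : ℕ} (_ : l + m + n ≤ N) (g : Fin l →o Fin m)
    (f : Fin m →o Fin n), map G X n l (f.comp g) = map G X n m f ≫ map G X m l g := by
  induction N with
  | zero =>
    intro l m n hN g f
    obtain rfl : l = 0 := by omega
    obtain rfl : m = 0 := by omega
    obtain rfl : n = 0 := by omega
    rw [map_zero_zero, map_zero_zero, map_zero_zero, Category.comp_id]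
  | succ N ih =>
    intro l m n hN g f
    rcases n with _ | n
    · rcases m with _ | m
      · rw [map_zero_zero G X f, Category.id_comp]
        congr 1
        exact OrderHom.ext _ _ (funext fun i => (g i).elim0)
      · exact (f 0).elim0
    by_cases hf : ∃ f' : Fin m →o Fin n, ∀ i, f i = (f' i).succ
    · obtain ⟨f', hf'⟩ := hf
      rw [map_eps G X f f' hf', map_eps G X (f.comp g) (f'.comp g) (fun i => hf' (g i)),
        ih (by omega)]
      exact (Category.assoc _ _ _).symm
    rcases m with _ | m
    · exact absurd ⟨⟨Fin.elim0, fun i => i.elim0⟩, fun i => i.elim0⟩ hf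
    have hf0 : f 0 = 0 := by
      by_contra h
      exact hf ⟨pred f h, eq_succ_pred f h⟩
    rw [map_of_eq G X f hf0]
    by_cases hg : ∃ g' : Fin l →o Fin m, ∀ i, g i = (g' i).succ
    · obtain ⟨g', hg'⟩ := hg
      rw [map_eps G X g g' hg', show f.comp g = (tail f).comp g' from
          OrderHom.ext _ _ (funext fun i => congrArg f (hg' i)), ih (by omega)]
      exact (map_comp_aux₁ G _ _).symm
    rcases l with _ | l
    · exact absurd ⟨⟨Fin.elim0, fun i => i.elim0⟩, fun i => i.elim0⟩ hg
    have hg0 : g 0 = 0 := by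
      by_contra h
      exact hg ⟨pred g h, eq_succ_pred g h⟩
    rw [map_of_eq G X g hg0, map_of_eq G X (f.comp g) ((congrArg f hg0).trans hf0),
      show tail (f.comp g) = f.comp (tail g) from rfl, ih (by omega), map_of_eq G X f hf0]
    exact (map_comp_aux₂ G _ _).symm

/-- The simplicial object with the terms `G^{n+1} X`. -/
def simplicialObject : SimplicialObject C where
  obj Δ := iter G X (Δ.unop.len + 1)
  map θ := map G X _ _ θ.unop.toOrderHom
  map_id _ := map_id G X _
  map_comp _ _ := map_comp G X _ le_rfl _ _

open Simplicial

/-- The face `d₀` is the counit on the factor `0`. -/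
theorem simplicialObject_δ_zero (n : ℕ) :
    (simplicialObject G X).δ (0 : Fin (n + 2)) = G.ε.app (iter G X (n + 1)) :=
  (map_eps G X _ OrderHom.id fun _ => rfl).trans
    ((congrArg _ (map_id G X _)).trans (Category.comp_id _))

/-- The face `d_{i+1}` is `d_i` applied inside the factor `0`. -/
theorem simplicialObject_δ_succ (n : ℕ) (i : Fin (n + 2)) :
    (simplicialObject G X).δ i.succ = G.map ((simplicialObject G X).δ i) := by
  refine map_inner G X _ _ rfl fun j => ?_
  exact Fin.succ_succAbove_succ i j

/-- The degeneracy `s₀` is the comultiplication on the factor `0`. -/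
theorem simplicialObject_σ_zero (n : ℕ) :
    (simplicialObject G X).σ (0 : Fin (n + 1)) = G.δ.app (iter G X n) := by
  refine (map_of_eq G X (SimplexCategory.σ (0 : Fin (n + 1))).toOrderHom rfl).trans ?_
  have : tail (SimplexCategory.σ (0 : Fin (n + 1))).toOrderHom = OrderHom.id :=
    OrderHom.ext _ _ (funext fun i => Fin.predAbove_zero_succ)
  exact (congrArg (fun f => G.δ.app (iter G X n) ≫ G.map (map G X (n + 1) (n + 1) f)) this).trans
    ((congrArg (fun f => G.δ.app (iter G X n) ≫ G.map f) (map_id G X (n + 1))).trans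
      ((congrArg _ (G.map_id _)).trans (Category.comp_id _)))

/-- The degeneracy `s_{j+1}` is `s_j` applied inside the factor `0`. -/
theorem simplicialObject_σ_succ (n : ℕ) (j : Fin (n + 1)) :
    (simplicialObject G X).σ j.succ = G.map ((simplicialObject G X).σ j) := by
  refine map_inner G X _ _ (Fin.predAbove_right_zero (i := j.succ)) fun i => ?_
  exact Fin.succ_predAbove_succ j i

end CotripleResolution

/-! ## Latching objects and Reedy cofibrant simplicial objects -/

section Latching

open Simplicial

variable {C : Type*} [Category C]

/-- The surjections `[n] → [m]` of the simplex category such that `m < n`. -/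
def latchingProperty (n : ℕ) : ObjectProperty (Under ⦋n⦌) :=
  fun f => Epi f.hom ∧ f.right.len < n

/-- The diagram of the objects `X_m`, indexed by the opposite of the category of surjections
`[n] → [m]` such that `m < n`. Its colimit is the `n`th latching object of `X`. -/
def latchingDiagram (X : SimplicialObject C) (n : ℕ) :
    (latchingProperty n).FullSubcategoryᵒᵖ ⥤ C :=
  ((latchingProperty n).ι ⋙ Under.forget _).op ⋙ X

/-- The cocone that is given by the degeneracy operators `X_m ⟶ X_n`. -/
def latchingCocone (X : SimplicialObject C) (n : ℕ) : Cocone (latchingDiagram X n) where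
  pt := X _⦋n⦌
  ι :=
    { app f := X.map f.unop.obj.hom.op
      naturality f g φ := by
        refine (X.map_comp _ _).symm.trans (Eq.trans ?_ (Category.comp_id _).symm)
        exact congrArg (fun θ => X.map (Quiver.Hom.op θ)) (Under.w φ.unop.hom) }

/-- The latching morphism `L_n X ⟶ X_n`, for a given colimit cocone `L` that represents the
latching object. -/
def latchingMap (X : SimplicialObject C) (n : ℕ) {L : Cocone (latchingDiagram X n)}
    (hL : IsColimit L) : L.pt ⟶ X _⦋n⦌ :=
  hL.desc (latchingCocone X n)

/-- A simplicial object is Reedy cofibrant (with respect to a class of cofibrations) when it has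
latching objects and when all its latching morphisms are cofibrations. -/
def IsReedyCofibrant (cof : MorphismProperty C) (X : SimplicialObject C) : Prop :=
  ∀ n : ℕ, ∃ (L : Cocone (latchingDiagram X n)) (hL : IsColimit L), cof (latchingMap X n hL)

end Latching

/-! ## The cotriple resolution and the tree-wise tensors -/

namespace BEAlgebra

variable {k : Type u} [Field k]

/-- The cotriple resolution `Res_•(A)`, with `Res_n(A) = S ∘ ⋯ ∘ S (A)` (`n + 1` factors). -/
noncomputable def Res (A : BEAlgebra k) : SimplicialObject (BEAlgebra k) :=
  CotripleResolution.simplicialObject (adj k).toComonad A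

/-- The generating dg-module `C_n(A) = S ∘ ⋯ ∘ S (A)` (`n` factors) of `Res_n(A)`. -/
noncomputable def gens (A : BEAlgebra k) (n : ℕ) : DGModule k :=
  (CotripleResolution.iter (adj k).toComonad A n).dg

open Simplicial in
theorem Res_eq (A : BEAlgebra k) (n : ℕ) : A.Res _⦋n⦌ = (free k).obj (A.gens n) := rfl

/-- The canonical embedding `M ⟶ S(M)`: the adjunction unit. -/
noncomputable def freeUnit (M : DGModule k) : M ⟶ ((free k).obj M).dg := (adj k).unit.app M

/-- The tree-wise tensors in `C_n(A)`: trees with `n` levels (the level `0` is the root), with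
vertices labeled by elements of the operad and leaves labeled by elements of `A`. The predicate
`u` records the levels that entirely consist of vertices with one ingoing edge. -/
inductive TreeTensor (A : BEAlgebra k) : ∀ n : ℕ, (Fin n → Prop) → A.gens n → Prop
  | leaf {p : ℤ} {a : A.dg} (ha : a ∈ A.dg.gr p) (u : Fin 0 → Prop) : TreeTensor A 0 u a
  | node {n r q : ℕ} {π : BarrattEccles k r} (hπ : π ∈ BarrattEccles.gr k r q)
      {x : Fin r → A.gens n} {u : Fin r → Fin n → Prop}
      (h : ∀ i, TreeTensor A n (u i) (x i)) :
      TreeTensor A (n + 1) (Fin.cons (α := fun _ => Prop) (r = 1) fun l => ∀ i, u i l)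
        (((free k).obj (A.gens n)).act r π fun i => (freeUnit (A.gens n)).lin (x i))

/-- The nondegenerate tree-wise tensors: no level entirely consists of vertices with one ingoing
edge. -/
def nondegTreeTensors (A : BEAlgebra k) (n : ℕ) : Set (A.gens n) :=
  {x | ∃ u : Fin n → Prop, (∀ l, ¬ u l) ∧ TreeTensor A n u x}

theorem TreeTensor.homogeneous {A : BEAlgebra k} {n : ℕ} {u : Fin n → Prop} {x : A.gens n}
    (h : TreeTensor A n u x) : ∃ p, x ∈ (A.gens n).gr p := by
  induction h with
  | leaf ha u => exact ⟨_, ha⟩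
  | @node n r q π hπ x u h ih =>
    choose p hp using ih
    exact ⟨_, ((free k).obj (A.gens n)).act_mem hπ
      fun i => (freeUnit (A.gens n)).map_gr (hp i)⟩

theorem _root_.BarrattEccles.d_mem {r q : ℕ} {e : BarrattEccles k r}
    (he : e ∈ BarrattEccles.gr k r q) :
    BarrattEccles.d k r e = 0 ∨ BarrattEccles.d k r e ∈ BarrattEccles.gr k r (q - 1) := by
  rw [BarrattEccles.gr_eq_span] at he
  rcases q with _ | q
  · left
    induction he using Submodule.span_induction with
    | mem e he => obtain ⟨σ, hσ, rfl⟩ := he; exact BarrattEccles.d_single_zero σ hσ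
    | zero => simp
    | add e f _ _ he hf => rw [map_add, he, hf, add_zero]
    | smul c e _ he => rw [map_smul, he, smul_zero]
  · right
    induction he using Submodule.span_induction with
    | mem e he => obtain ⟨σ, hσ, rfl⟩ := he; exact BarrattEccles.d_single_mem σ q hσ
    | zero => simp
    | add e f _ _ he hf => rw [map_add]; exact Submodule.add_mem _ he hf
    | smul c e _ he => rw [map_smul]; exact Submodule.smul_mem _ c he

theorem d_act_mem {M : DGModule k} {B : BEAlgebra k} (ι : M ⟶ B.dg) {r q : ℕ}
    {π : BarrattEccles k r} (hπ : π ∈ BarrattEccles.gr k r q) {x : Fin r → M} {p : Fin r → ℤ}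
    (hp : ∀ i, x i ∈ M.gr (p i)) (G : Fin r → Set M) (hx : ∀ i, x i ∈ G i)
    (hd : ∀ i, M.d (x i) ∈ Submodule.span k (G i)) (W : Submodule k B.dg)
    (hW : ∀ (q' : ℕ) (π' : BarrattEccles k r), π' ∈ BarrattEccles.gr k r q' →
      ∀ y : Fin r → M, (∀ i, y i ∈ G i) → B.act r π' (fun i => ι.lin (y i)) ∈ W) :
    B.dg.d (B.act r π fun i => ι.lin (x i)) ∈ W := by
  rw [B.d_act hπ fun i => ι.map_gr (hp i)]
  refine Submodule.add_mem _ ?_ (Submodule.sum_mem _ fun i _ =>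
    BarrattEccles.negOnePow_smul_mem _ _ ?_)
  · rcases BarrattEccles.d_mem hπ with h0 | h1
    · rw [h0, map_zero, zero_apply]; exact W.zero_mem
    · exact hW _ _ h1 x hx
  · have := ((B.act r π).compLinearMap fun _ => ι.lin).mem_of_span W G (hW q π hπ)
      (Function.update x i (M.d (x i))) (fun j => by
        by_cases hj : j = i
        · subst hj; rw [Function.update_self]; exact hd j
        · rw [Function.update_of_ne hj]; exact Submodule.subset_span (hx j))
    have e : (fun j => ι.lin (Function.update x i (M.d (x i)) j)) =
        Function.update (fun j => ι.lin (x j)) i (B.dg.d (ι.lin (x i))) := by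
      ext1 j
      by_cases hj : j = i
      · subst hj
        rw [Function.update_self, Function.update_self]
        exact ι.map_d _
      · rw [Function.update_of_ne hj, Function.update_of_ne hj]
    rw [← e]
    exact this

theorem TreeTensor.d_mem {A : BEAlgebra k} {n : ℕ} {u : Fin n → Prop} {x : A.gens n}
    (h : TreeTensor A n u x) : (A.gens n).d x ∈ Submodule.span k {y | TreeTensor A n u y} := by
  induction h with
  | leaf ha u => exact Submodule.subset_span (TreeTensor.leaf (A.dg.d_mem ha) u)
  | @node n r q π hπ x u h ih =>
    choose p hp using fun i => (h i).homogeneous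
    have key := d_act_mem (freeUnit (A.gens n)) hπ hp (fun i => {y | TreeTensor A n (u i) y}) h ih
    let W : Submodule k (A.gens (n + 1)) := Submodule.span k
      {y | TreeTensor A (n + 1) (Fin.cons (α := fun _ => Prop) (r = 1) fun l => ∀ i, u i l) y}
    exact key W fun q' π' hπ' y hy =>
      @Submodule.subset_span k (A.gens (n + 1)) _ _ _ _ _ (TreeTensor.node hπ' hy)

theorem nondegTreeTensors_homogeneous (A : BEAlgebra k) (n : ℕ) :
    ∀ x ∈ A.nondegTreeTensors n, ∃ p, x ∈ (A.gens n).gr p := by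
  rintro x ⟨u, hu, h⟩
  exact h.homogeneous

theorem nondegTreeTensors_d (A : BEAlgebra k) (n : ℕ) :
    ∀ x ∈ A.nondegTreeTensors n, (A.gens n).d x ∈ Submodule.span k (A.nondegTreeTensors n) := by
  rintro x ⟨u, hu, h⟩
  have hs : {y | TreeTensor A n u y} ⊆ A.nondegTreeTensors n := fun _ hy => ⟨u, hu, hy⟩
  exact Submodule.span_mono hs h.d_mem

/-- The dg-module `N_n C_•(A)`: the submodule of `C_n(A)` spanned by the nondegenerate tree-wise
tensors. -/
noncomputable def nondeg (A : BEAlgebra k) (n : ℕ) : DGModule k :=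
  (A.gens n).ofSpan (A.nondegTreeTensors n) (A.nondegTreeTensors_homogeneous n)
    (A.nondegTreeTensors_d n)

/-- The inclusion of `N_n C_•(A)` in `C_n(A)`. -/
noncomputable def nondegIncl (A : BEAlgebra k) (n : ℕ) : A.nondeg n ⟶ A.gens n :=
  (A.gens n).ofSpanIncl (A.nondegTreeTensors n) (A.nondegTreeTensors_homogeneous n)
    (A.nondegTreeTensors_d n)

open Simplicial in
/-- The morphism of free algebras `S(N_n C_•(A)) ⟶ S(C_n(A)) = Res_n(A)`. -/
noncomputable def freeNondegIncl (A : BEAlgebra k) (n : ℕ) :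
    (free k).obj (A.nondeg n) ⟶ A.Res _⦋n⦌ :=
  (free k).map (A.nondegIncl n)

end BEAlgebra

/-!
The cotriple resolution `Res_n(A) = S(C_n(A))`, with `C_n(A) = S^n(A)`, has degeneracies of the
form `S(t_j)`, where the morphism of dg-modules `t_j : C_n(A) ⟶ C_{n+1}(A)` inserts a level of
unary vertices in position `j` (`BEAlgebra.insertLevel`, `BEAlgebra.Res_σ`). Hence the latching
problem takes place in dg-modules, and it is solved there by a splitting.

Since `E(0) = 0` and `E(1) = k`, every dg-module `M` is a trivial algebra, on which the operations
of arity `r ≠ 1` vanish. The induced projection `S(M) ⟶ M` is a retraction of the unit `M ⟶ S(M)`,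
and kills all operations of arity `r ≠ 1`. Applied to the factor `j` of `C_{n+1}(A)`, it gives a
retraction `q_j` of `t_j` (`BEAlgebra.deleteLevel`), and the `q_j` and `t_i` satisfy the obvious
identities. A tree-wise tensor is fixed by `t_j q_j` when its level `j` consists of unary vertices,
and is killed by `q_j` otherwise (`TreeTensor.levelProj_apply`). Tree-wise tensors span `C_n(A)`
(`BEAlgebra.span_treeTensors`), because composites of operations reduce to single operations.

The retractions allow one to extend any family of morphisms on the sources of the `t_j`, compatible
with the simplicial identities, to a morphism on `C_{n+1}(A)` that vanishes on `N_{n+1} C_•(A)`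
(`BEAlgebra.exists_extension`); the correction of the extension one degeneracy at a time is the
argument that shows that simplicial groups are Kan complexes. The extension of the `t_j` themselves
is an idempotent `P`, whose image is spanned by the degenerate tensors and whose kernel is
`N_n C_•(A)`. The free algebra on the image of `P` is the latching object
(`BEAlgebra.exists_latching_colimit`), and the splitting `C_n(A) = im P ⊕ N_n C_•(A)` gives the
coproduct decomposition of `Res_n(A)` (`BEAlgebra.exists_isColimit_latching`).

The latching morphism is then a cofibration because morphisms of dg-modules lift along acyclic
fibrations: over a field, an acyclic fibration has a graded linear section, which a contraction of
the kernel corrects into a section of dg-modules (`DGModule.exists_section_of_acyclic_fibration`).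
-/

/-! ### Dg-modules over a field are cofibrant -/

namespace DGModule

variable {k : Type u} [Field k]

instance (K L : DGModule k) : Zero (K ⟶ L) :=
  ⟨Hom.mk 0 (fun _ => Submodule.zero_mem _) (fun _ => (map_zero L.d).symm)⟩

instance (K L : DGModule k) : Add (K ⟶ L) :=
  ⟨fun f g => Hom.mk (f.lin + g.lin)
    (fun h => Submodule.add_mem _ (f.map_gr h) (g.map_gr h))
    (fun x => by simp only [LinearMap.add_apply, f.map_d, g.map_d, map_add])⟩

instance (K L : DGModule k) : Neg (K ⟶ L) :=
  ⟨fun f => Hom.mk (-f.lin) (fun h => Submodule.neg_mem _ (f.map_gr h))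
    (fun x => by simp only [LinearMap.neg_apply, f.map_d, map_neg])⟩

theorem add_lin {K L : DGModule k} (f g : K ⟶ L) (x : K) :
    (f + g).lin x = f.lin x + g.lin x := rfl

theorem neg_lin {K L : DGModule k} (f : K ⟶ L) (x : K) : (-f).lin x = -f.lin x := rfl

theorem id_lin {K : DGModule k} (x : K) : Hom.lin (𝟙 K) x = x := rfl

theorem comp_lin {K L N : DGModule k} (f : K ⟶ L) (g : L ⟶ N) (x : K) :
    (f ≫ g).lin x = g.lin (f.lin x) := rfl

instance : Preadditive (DGModule k) where
  homGroup K L :=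
    { add_assoc := fun f g h => hom_ext fun x => add_assoc (f.lin x) (g.lin x) (h.lin x)
      zero_add := fun f => hom_ext fun x => zero_add (f.lin x)
      add_zero := fun f => hom_ext fun x => add_zero (f.lin x)
      add_comm := fun f g => hom_ext fun x => add_comm (f.lin x) (g.lin x)
      neg_add_cancel := fun f => hom_ext fun x => neg_add_cancel (f.lin x)
      nsmul := nsmulRec
      zsmul := zsmulRec }
  add_comp _ _ _ f g h := hom_ext fun x => map_add h.lin (f.lin x) (g.lin x)
  comp_add _ _ _ _ _ _ := rfl

theorem sub_lin {K L : DGModule k} (f g : K ⟶ L) (x : K) :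
    (f - g).lin x = f.lin x - g.lin x := by
  rw [sub_eq_add_neg, sub_eq_add_neg, add_lin, neg_lin]

/-- The projection onto the component of degree `n`, as an endomorphism of `K`. -/
noncomputable def component (K : DGModule k) (n : ℤ) : K →ₗ[k] K :=
  BEAlgebra.ofGr K fun p => if p = n then (K.gr p).subtype else 0

theorem component_apply {K : DGModule k} {n p : ℤ} {x : K} (hx : x ∈ K.gr p) :
    K.component n x = if p = n then x else 0 := by
  rw [component, BEAlgebra.ofGr_apply K _ ⟨x, hx⟩]
  split_ifs <;> rfl

theorem component_mem (K : DGModule k) (n : ℤ) (x : K) : K.component n x ∈ K.gr n := by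
  have h : x ∈ ⨆ p, K.gr p := by rw [K.iSup_gr]; trivial
  induction h using Submodule.iSup_induction' with
  | mem p x hx =>
    rw [component_apply hx]
    split_ifs with h
    · exact h ▸ hx
    · exact Submodule.zero_mem _
  | zero => rw [map_zero]; exact Submodule.zero_mem _
  | add x y _ _ hx hy => rw [map_add]; exact Submodule.add_mem _ hx hy

theorem map_component {K L : DGModule k} (f : K →ₗ[k] L) (c : ℤ)
    (hf : ∀ p, ∀ x ∈ K.gr p, f x ∈ L.gr (p + c)) (n : ℤ) (x : K) :
    f (K.component n x) = L.component (n + c) (f x) := by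
  refine LinearMap.congr_fun (f := f ∘ₗ K.component n) (g := L.component (n + c) ∘ₗ f)
    (BEAlgebra.ext_gr fun p x hx => ?_) x
  rw [LinearMap.comp_apply, LinearMap.comp_apply, component_apply hx,
    component_apply (hf p x hx)]
  simp only [add_left_inj]
  split_ifs
  · rfl
  · exact map_zero f

/-- A linear map over a field has a generalized inverse. -/
theorem exists_linear_section {V W : Type*} [AddCommGroup V] [Module k V] [AddCommGroup W]
    [Module k W] (f : V →ₗ[k] W) : ∃ s : W →ₗ[k] V, ∀ x, f (s (f x)) = f x := by
  obtain ⟨s, hs⟩ := f.rangeRestrict.exists_rightInverse_of_surjective f.range_rangeRestrict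
  obtain ⟨s', hs'⟩ := s.exists_extend
  refine ⟨s', fun x => ?_⟩
  have h1 := LinearMap.congr_fun hs' (f.rangeRestrict x)
  have h2 := congrArg Subtype.val (LinearMap.congr_fun hs (f.rangeRestrict x))
  exact (congrArg f h1).trans h2

/-- A graded linear map over a field, restricted to graded submodules `V n` of its source, has a
graded generalized inverse with values in these submodules. -/
theorem exists_graded_section {K L : DGModule k} (f : K →ₗ[k] L) (V : ℤ → Submodule k K)
    (c : ℤ) (hf : ∀ n, ∀ x ∈ V n, f x ∈ L.gr (n + c)) :
    ∃ s : L →ₗ[k] K, (∀ n, ∀ y ∈ L.gr (n + c), s y ∈ V n) ∧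
      ∀ n, ∀ x ∈ V n, f (s (f x)) = f x := by
  choose s hs using fun n => exists_linear_section
    (f.restrict (p := V (n - c)) (q := L.gr n) fun x hx => by
      have := hf _ x hx; rwa [sub_add_cancel] at this)
  refine ⟨BEAlgebra.ofGr L fun n => (V (n - c)).subtype ∘ₗ s n, fun n y hy => ?_,
    fun n x hx => ?_⟩
  · rw [BEAlgebra.ofGr_apply L _ ⟨y, hy⟩]
    exact (congrArg V (add_sub_cancel_right n c)).le (s (n + c) ⟨y, hy⟩).2
  · rw [BEAlgebra.ofGr_apply L _ ⟨f x, hf n x hx⟩]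
    have hx' : x ∈ V (n + c - c) := by rwa [add_sub_cancel_right]
    exact congrArg Subtype.val (hs (n + c) ⟨x, hx'⟩)

theorem surjective_of_fibration {X Y : DGModule k} {p : X ⟶ Y} (hp : fibrations k p) :
    Function.Surjective p.lin := by
  rw [← LinearMap.range_eq_top, eq_top_iff, ← Y.iSup_gr]
  refine iSup_le fun n y hy => ?_
  obtain ⟨x, -, hx⟩ := hp n y hy
  exact ⟨x, hx⟩

/-- The kernel of an acyclic fibration is acyclic. -/
theorem exists_boundary_of_acyclic_fibration {X Y : DGModule k} {p : X ⟶ Y}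
    (hp : fibrations k p) (hw : weakEquivalences k p) {n : ℤ} {z : X} (hz : z ∈ X.gr n)
    (hpz : p.lin z = 0) (hdz : X.d z = 0) : ∃ w ∈ X.gr (n + 1), p.lin w = 0 ∧ X.d w = z := by
  have hX : ∀ {x : X} (hx : X.d x = 0), x ∈ X.cycles := fun hx => hx
  obtain ⟨x, hx⟩ : ∃ x, X.d x = z := by
    have h0 : Submodule.Quotient.mk (p := X.boundaries) ⟨z, hX hdz⟩ = 0 := by
      refine hw.1 ?_
      rw [map_zero]
      refine (Submodule.Quotient.mk_eq_zero _).2 ⟨0, ?_⟩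
      rw [map_zero]
      exact hpz.symm
    exact (Submodule.Quotient.mk_eq_zero _).1 h0
  have hpx : Y.d (p.lin x) = 0 := by rw [← p.map_d, hx, hpz]
  obtain ⟨x', hx'⟩ := hw.2 (Submodule.Quotient.mk (p := Y.boundaries) ⟨p.lin x, hpx⟩)
  obtain ⟨⟨x', hdx'⟩, rfl⟩ := Submodule.Quotient.mk_surjective _ x'
  obtain ⟨y, hy⟩ := (Submodule.Quotient.eq Y.boundaries).1 hx'
  obtain ⟨x'', rfl⟩ := surjective_of_fibration hp y
  have hy' : Y.d (p.lin x'') = p.lin x' - p.lin x := hy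
  have hdx'' : X.d x' = 0 := hdx'
  let w := x - x' + X.d x''
  have hpw : p.lin w = 0 := by
    simp only [w, map_add, map_sub, p.map_d, hy']
    abel
  have hdw : X.d w = z := by
    simp only [w, map_add, map_sub, X.d_d, hdx'', hx]
    abel
  refine ⟨X.component (n + 1) w, X.component_mem _ _, ?_, ?_⟩
  · rw [map_component p.lin 0 (fun q x hx => by rw [add_zero]; exact p.map_gr hx), hpw, map_zero]
  · rw [map_component X.d (-1) (fun q x hx => X.d_mem hx), hdw, component_apply hz,
      if_pos (by ring)]

/-- An acyclic fibration of dg-modules over a field has a section. A graded linear section is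
corrected by means of a contraction of the kernel. -/
theorem exists_section_of_acyclic_fibration {X Y : DGModule k} {p : X ⟶ Y}
    (hp : fibrations k p) (hw : weakEquivalences k p) : ∃ s : Y ⟶ X, s ≫ p = 𝟙 Y := by
  obtain ⟨s, hs, hs'⟩ := exists_graded_section p.lin X.gr 0
    fun n x hx => by rw [add_zero]; exact p.map_gr hx
  obtain ⟨t, ht, ht'⟩ := exists_graded_section X.d (fun n => X.gr n ⊓ LinearMap.ker p.lin) (-1)
    fun n x hx => X.d_mem hx.1
  have hps : ∀ y, p.lin (s y) = y := by
    intro y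
    refine LinearMap.congr_fun (f := p.lin ∘ₗ s) (g := LinearMap.id)
      (BEAlgebra.ext_gr fun n y hy => ?_) y
    obtain ⟨x, hx, rfl⟩ := hp n y hy
    exact hs' n x hx
  have hpt : ∀ x, p.lin (t x) = 0 := by
    intro x
    refine LinearMap.congr_fun (f := p.lin ∘ₗ t) (g := 0)
      (BEAlgebra.ext_gr fun n x hx => ?_) x
    exact (ht (n + 1) x (by rwa [add_neg_cancel_right])).2
  have htz : ∀ n, ∀ z ∈ X.gr n, p.lin z = 0 → X.d z = 0 → X.d (t z) = z := by
    intro n z hz hpz hdz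
    obtain ⟨w, hw1, hw2, rfl⟩ := exists_boundary_of_acyclic_fibration hp hw hz hpz hdz
    exact ht' (n + 1) w ⟨hw1, hw2⟩
  have ht_mem : ∀ n, ∀ x ∈ X.gr n, t x ∈ X.gr (n + 1) := fun n x hx =>
    (ht (n + 1) x (by rwa [add_neg_cancel_right])).1
  have hs_mem : ∀ n, ∀ y ∈ Y.gr n, s y ∈ X.gr n := fun n y hy =>
    hs n y (by rwa [add_zero])
  -- The failure of `s` to commute with differentials, with values in the kernel of `p`.
  let δ : Y →ₗ[k] X := X.d ∘ₗ s - s ∘ₗ Y.d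
  have hδ : ∀ y, δ y = X.d (s y) - s (Y.d y) := fun _ => rfl
  have hpδ : ∀ y, p.lin (δ y) = 0 := by
    intro y
    rw [hδ, map_sub, p.map_d, hps, hps, sub_self]
  have hδ_mem : ∀ n, ∀ y ∈ Y.gr n, δ y ∈ X.gr (n - 1) := fun n y hy =>
    Submodule.sub_mem _ (X.d_mem (hs_mem n y hy)) (hs_mem _ _ (Y.d_mem hy))
  have hdδ : ∀ y, X.d (δ y) = - δ (Y.d y) := by
    intro y
    rw [hδ, hδ, map_sub, X.d_d, Y.d_d, map_zero]
    abel
  -- The contraction `h = t ∘ (1 - t ∘ d)` of the kernel of `p`.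
  let h : X →ₗ[k] X := t ∘ₗ (LinearMap.id - t ∘ₗ X.d)
  have hh : ∀ x, h x = t (x - t (X.d x)) := fun _ => rfl
  have hdt : ∀ n, ∀ x ∈ X.gr n, p.lin x = 0 → X.d (t (X.d x)) = X.d x := fun n x hx hpx =>
    htz (n - 1) _ (X.d_mem hx) (by rw [p.map_d, hpx, map_zero]) (X.d_d x)
  have hdh : ∀ n, ∀ x ∈ X.gr n, p.lin x = 0 → X.d (h x) + h (X.d x) = x := by
    intro n x hx hpx
    have h1 : X.d (h x) = x - t (X.d x) := by
      rw [hh]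
      refine htz n _ (Submodule.sub_mem _ hx ?_) ?_ ?_
      · have := ht_mem _ _ (X.d_mem hx)
        rwa [sub_add_cancel] at this
      · rw [map_sub, hpx, hpt, sub_zero]
      · rw [map_sub, hdt n x hx hpx, sub_self]
    rw [h1, hh, X.d_d, map_zero, sub_zero, sub_add_cancel]
  refine ⟨Hom.mk (s - h ∘ₗ δ) (fun {n y} hy => ?_) (fun y => ?_), hom_ext fun y => ?_⟩
  · have h1 := hδ_mem n y hy
    have h2 := Submodule.sub_mem _ h1 (ht_mem _ _ (X.d_mem h1) |> fun h => by
      rwa [sub_add_cancel] at h)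
    have h3 := ht_mem _ _ h2
    rw [sub_add_cancel] at h3
    exact Submodule.sub_mem _ (hs_mem n y hy) h3
  · refine LinearMap.congr_fun (f := (s - h ∘ₗ δ) ∘ₗ Y.d) (g := X.d ∘ₗ (s - h ∘ₗ δ))
      (BEAlgebra.ext_gr fun n y hy => ?_) y
    simp only [LinearMap.comp_apply, LinearMap.sub_apply, map_sub]
    have h1 := hdh _ _ (hδ_mem n y hy) (hpδ y)
    rw [hdδ, map_neg] at h1
    rw [← sub_eq_zero]
    have h2 : δ y = X.d (s y) - s (Y.d y) := rfl
    calc _ = (X.d (h (δ y)) + -h (δ (Y.d y))) - (X.d (s y) - s (Y.d y)) := by abel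
      _ = 0 := by rw [h1, h2, sub_self]
  · change p.lin (s y - t (δ y - t (X.d (δ y)))) = y
    rw [map_sub, hpt, hps, sub_zero]

/-- Morphisms out of any dg-module lift along acyclic fibrations. -/
theorem exists_lift_acyclic_fibration (K : DGModule k) {X Y : DGModule k} {p : X ⟶ Y}
    (hp : fibrations k p) (hw : weakEquivalences k p) (g : K ⟶ Y) : ∃ l : K ⟶ X, l ≫ p = g := by
  obtain ⟨s, hs⟩ := exists_section_of_acyclic_fibration hp hw
  exact ⟨g ≫ s, by rw [Category.assoc, hs, Category.comp_id]⟩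

/-- The zero dg-module. -/
def zeroObj (k : Type u) [Field k] : DGModule k where
  carrier := PUnit
  gr _ := ⊤
  isInternal := DGModule.isInternal_of_proj _ (fun _ => 0) (fun _ _ _ => rfl) (fun _ _ _ _ _ => rfl)
    (ciSup_const (ι := ℤ))
  d := 0
  d_mem _ := trivial
  d_d _ := rfl

/-- The zero dg-module is initial. -/
def zeroObjIsInitial : IsInitial (zeroObj k) :=
  IsInitial.ofUniqueHom (fun _ => 0) fun _ f =>
    hom_ext fun x => (congrArg f.lin (Subsingleton.elim (α := PUnit) x 0)).trans (map_zero f.lin)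

theorem isCofibrant (K : DGModule k) : K.IsCofibrant := by
  refine ⟨zeroObj k, zeroObjIsInitial, fun X Y p hp => ⟨fun {f g} sq => ?_⟩⟩
  obtain ⟨l, hl⟩ := K.exists_lift_acyclic_fibration hp.1 hp.2 g
  exact ⟨⟨⟨l, zeroObjIsInitial.hom_ext _ _, hl⟩⟩⟩

/-- Idempotent endomorphisms of dg-modules split. -/
theorem exists_splitting {K : DGModule k} (e : K ⟶ K) (he : e ≫ e = e) :
    ∃ (D : DGModule k) (i : D ⟶ K) (r : K ⟶ D), i ≫ r = 𝟙 D ∧ r ≫ i = e := by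
  let s : Set K := {x | (∃ p, x ∈ K.gr p) ∧ e.lin x = x}
  have hs : ∀ x ∈ s, ∃ n, x ∈ K.gr n := fun x hx => hx.1
  have hd : ∀ x ∈ s, K.d x ∈ Submodule.span k s := by
    rintro x ⟨⟨p, hp⟩, hx⟩
    exact Submodule.subset_span ⟨⟨_, K.d_mem hp⟩, by rw [e.map_d, hx]⟩
  have he' : ∀ x, e.lin (e.lin x) = e.lin x := fun x =>
    LinearMap.congr_fun (congrArg Hom.lin he) x
  have hes : ∀ x, e.lin x ∈ Submodule.span k s := by
    have : (⊤ : Submodule k K) ≤ (Submodule.span k s).comap e.lin := by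
      rw [← K.iSup_gr]
      exact iSup_le fun p x hx => Submodule.subset_span ⟨⟨p, e.map_gr hx⟩, he' x⟩
    exact fun x => this trivial
  have hfix : ∀ x ∈ Submodule.span k s, e.lin x = x := by
    have : Submodule.span k s ≤ LinearMap.eqLocus e.lin LinearMap.id :=
      Submodule.span_le.2 fun x hx => hx.2
    exact fun x hx => this hx
  refine ⟨K.ofSpan s hs hd, K.ofSpanIncl s hs hd, Hom.mk (e.lin.codRestrict _ hes)
    (fun hx => e.map_gr hx) (fun x => Subtype.ext (e.map_d x)), ?_, ?_⟩
  · exact hom_ext fun x => Subtype.ext (hfix x.1 x.2)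
  · exact hom_ext fun x => rfl

end DGModule

/-! ### The augmentation of the free algebra functor -/

namespace BarrattEccles

variable {k : Type u} [Field k]

theorem dim_eq_zero (σ : BESimplex 1) : σ.dim = 0 := by
  by_contra h
  exact σ.nondeg ⟨0, Nat.pos_of_ne_zero h⟩ (Subsingleton.elim _ _)

instance : Unique (BESimplex 1) where
  default := ⟨one_pos, 0, fun _ => 1, fun i => i.elim0⟩
  uniq := by
    rintro ⟨pos, dim, w, nd⟩
    obtain rfl : dim = 0 := dim_eq_zero ⟨pos, dim, w, nd⟩
    obtain rfl : w = fun _ => 1 := funext fun _ => Subsingleton.elim _ _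
    rfl

instance : IsEmpty (BESimplex 0) := ⟨fun σ => lt_irrefl _ σ.pos⟩

theorem cls_one (w : Fin (0 + 1) → Equiv.Perm (Fin 1)) :
    cls k w = Finsupp.single default 1 := by
  unfold cls
  rw [dif_pos ⟨one_pos, fun i => i.elim0⟩]
  congr 1
  exact Subsingleton.elim _ _

/-- The coefficient of the operad unit in an element of arity one. -/
noncomputable def unitCoeff (k : Type u) [Field k] : BarrattEccles k 1 →ₗ[k] k :=
  Finsupp.lapply default

theorem eq_smul_one (e : BarrattEccles k 1) : e = unitCoeff k e • one k := by
  rw [one, cls_one, Finsupp.smul_single, smul_eq_mul, mul_one]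
  exact Finsupp.unique_ext (by simp [unitCoeff])

theorem unitCoeff_one : unitCoeff k (one k) = 1 := by
  rw [one, cls_one]
  exact Finsupp.single_eq_same

theorem unitCoeff_of_pos {q : ℕ} (hq : 0 < q) {e : BarrattEccles k 1} (he : e ∈ gr k 1 q) :
    unitCoeff k e = 0 := by
  by_contra h
  have : (default : BESimplex 1).dim = q := he (Finsupp.mem_support_iff.2 h)
  exact hq.ne' (this.symm.trans (dim_eq_zero _))

theorem d_arity_one (e : BarrattEccles k 1) : d k 1 e = 0 := by
  rw [eq_smul_one e, map_smul, one, cls_one, d_single_zero _ rfl, smul_zero]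

theorem perm_arity_one (s : Equiv.Perm (Fin 1)) (e : BarrattEccles k 1) : perm k s e = e := by
  rw [eq_smul_one e, map_smul]
  congr 1
  rw [one, cls_one]
  simp only [perm, Finsupp.linearCombination_single, one_smul]
  exact cls_one _

open Classical in
theorem comp_one_one : comp k (0 : Fin (0 + 1)) (one k) (one k) = one k := by
  have key : (∑ φ : Fin 1 → Fin 1 × Fin 1 with StrictMono φ,
      (pathInv (p := 0) (q := 0) φ : ℤ).negOnePow •
        (Finsupp.single default 1 : BarrattEccles k 1)) = Finsupp.single default 1 := by
    rw [Finset.sum_eq_single (fun _ => 0) (fun φ _ h => absurd (Subsingleton.elim φ _) h)]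
    · simp [pathInv]
    · intro h
      exact absurd (Finset.mem_filter.2 ⟨Finset.mem_univ _,
        fun a b hab => absurd hab (by simp [Subsingleton.elim a b])⟩) h
  rw [one, cls_one]
  simp only [comp, Finsupp.linearCombination_single, one_smul]
  refine Eq.trans (Finset.sum_congr rfl fun φ _ => ?_) key
  exact congrArg _ (cls_one _)

theorem unitCoeff_comp (e f : BarrattEccles k 1) :
    unitCoeff k (comp k (0 : Fin (0 + 1)) e f) = unitCoeff k e * unitCoeff k f := by
  have h : ∀ c d : k, comp k (0 : Fin (0 + 1)) (c • one k : BarrattEccles k 1) (d • one k) =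
      d • c • (one k : BarrattEccles k 1) := by
    intro c d
    refine (map_smul _ d _).trans (congrArg (d • ·) ?_)
    exact (LinearMap.map_smul₂ (comp k (0 : Fin (0 + 1))) c _ _).trans
      (congrArg (c • ·) comp_one_one)
  conv_lhs => rw [eq_smul_one e, eq_smul_one f]
  refine (congrArg (unitCoeff k) (h _ _)).trans ?_
  rw [map_smul, map_smul, unitCoeff_one, smul_eq_mul, smul_eq_mul, mul_one, mul_comm]

end BarrattEccles

namespace DGModule

open BarrattEccles

variable {k : Type u} [Field k]

/-- The operations of the trivial algebra: the operad acts through the augmentation that kills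
the components of arity `r ≠ 1`. -/
noncomputable def trivialAct (M : DGModule k) :
    ∀ r, BarrattEccles k r →ₗ[k] MultilinearMap k (fun _ : Fin r => M) M
  | 1 => (unitCoeff k).smulRight
      (MultilinearMap.ofSubsingleton k M M (0 : Fin 1) LinearMap.id)
  | _ => 0

theorem trivialAct_one {M : DGModule k} (e : BarrattEccles k 1) (a : Fin 1 → M) :
    M.trivialAct 1 e a = unitCoeff k e • a 0 := rfl

theorem trivialAct_of_ne {M : DGModule k} {r : ℕ} (hr : r ≠ 1) (e : BarrattEccles k r)
    (a : Fin r → M) : M.trivialAct r e a = 0 := by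
  rcases r with _ | _ | r
  · rfl
  · exact absurd rfl hr
  · rfl

/-- The trivial algebra structure on a dg-module. -/
noncomputable def trivialAlgebra (M : DGModule k) : BEAlgebra k where
  dg := M
  act := M.trivialAct
  act_mem := by
    intro r q e a p he ha
    by_cases hr : r = 1
    · subst hr
      rw [trivialAct_one]
      rcases Nat.eq_zero_or_pos q with rfl | hq
      · simpa using Submodule.smul_mem _ _ (ha 0)
      · rw [unitCoeff_of_pos hq he, zero_smul]
        exact Submodule.zero_mem _
    · rw [trivialAct_of_ne hr]
      exact Submodule.zero_mem _
  d_act := by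
    intro r q e a p he ha
    by_cases hr : r = 1
    · subst hr
      simp only [d_arity_one, map_zero, zero_apply, zero_add, trivialAct_one, map_smul]
      rcases Nat.eq_zero_or_pos q with rfl | hq
      · simp
      · simp [unitCoeff_of_pos hq he]
    · simp only [trivialAct_of_ne hr, map_zero, smul_zero, Finset.sum_const_zero, add_zero]
  act_perm := by
    intro r s e a p ha
    by_cases hr : r = 1
    · subst hr
      have h0 : koszulExp s p = 0 := Finset.sum_eq_zero fun ij hij =>
        absurd (Finset.mem_filter.1 hij).2.1 (by simp [Subsingleton.elim ij.1 ij.2])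
      rw [perm_arity_one, h0, Int.negOnePow_zero, one_smul, Subsingleton.elim s 1]
      rfl
    · rw [trivialAct_of_ne hr, trivialAct_of_ne hr, smul_zero]
  act_one a := by rw [trivialAct_one, unitCoeff_one, one_smul]
  act_comp := by
    intro m n q i e f a p hf ha
    by_cases hm : m = 0
    · subst hm
      obtain rfl : i = 0 := Subsingleton.elim (α := Fin 1) i 0
      by_cases hn : n = 1
      · subst hn
        have h1 : ∑ j : Fin (0 + 1) with j.val < (0 : Fin (0 + 1)).val, p j = 0 := by simp
        rw [h1, mul_zero, Int.negOnePow_zero, one_smul]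
        change unitCoeff k e • unitCoeff k f • a 0 = unitCoeff k (comp k 0 e f) • a 0
        rw [unitCoeff_comp, mul_smul]
      · rw [trivialAct_of_ne hn, trivialAct_of_ne (r := 0 + n) (by omega), smul_zero]
        change unitCoeff k e • (0 : M) = 0
        rw [smul_zero]
    · rw [trivialAct_of_ne (by omega)]
      by_cases hn : n = 0
      · subst hn
        rw [Subsingleton.elim f 0, map_zero, map_zero, zero_apply, smul_zero]
      · rw [trivialAct_of_ne (by omega), smul_zero]

end DGModule

namespace BEAlgebra

open BarrattEccles

variable {k : Type u} [Field k]

/-- The projection of the free algebra onto its generators. -/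
noncomputable def freeCounit (M : DGModule k) : ((free k).obj M).dg ⟶ M :=
  (((adj k).homEquiv M M.trivialAlgebra).symm (𝟙 M)).dgHom

theorem freeUnit_freeCounit (M : DGModule k) : freeUnit M ≫ freeCounit M = 𝟙 M := by
  have := ((adj k).homEquiv M M.trivialAlgebra).apply_symm_apply (𝟙 M)
  rwa [Adjunction.homEquiv_unit] at this

theorem freeCounit_freeUnit_apply {M : DGModule k} (x : M) :
    (freeCounit M).lin ((freeUnit M).lin x) = x :=
  LinearMap.congr_fun (congrArg DGModule.Hom.lin (freeUnit_freeCounit M)) x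

theorem act_arity_one (B : BEAlgebra k) (e : BarrattEccles k 1) (a : Fin 1 → B.dg) :
    B.act 1 e a = unitCoeff k e • a 0 := by
  conv_lhs => rw [eq_smul_one e, map_smul, smul_apply, B.act_one]

theorem freeCounit_act {M : DGModule k} {r : ℕ} (hr : r ≠ 1) (e : BarrattEccles k r)
    (a : Fin r → ((free k).obj M).dg) :
    (freeCounit M).lin (((free k).obj M).act r e a) = 0 :=
  ((((adj k).homEquiv M M.trivialAlgebra).symm (𝟙 M)).map_act e a).trans
    (DGModule.trivialAct_of_ne hr e _)

end BEAlgebra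

/-! ### Insertion and deletion of levels in tree-wise tensors -/

namespace BEAlgebra

open BarrattEccles

variable {k : Type u} [Field k]

/-- The functor `S`, with values in dg-modules, on morphisms. -/
noncomputable def freeDGMap {M N : DGModule k} (f : M ⟶ N) :
    ((free k).obj M).dg ⟶ ((free k).obj N).dg :=
  ((free k).map f).dgHom

theorem freeDGMap_id (M : DGModule k) : freeDGMap (𝟙 M) = 𝟙 _ :=
  congrArg Hom.dgHom ((free k).map_id M)

theorem freeDGMap_comp {M N P : DGModule k} (f : M ⟶ N) (g : N ⟶ P) :
    freeDGMap (f ≫ g) = freeDGMap f ≫ freeDGMap g :=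
  congrArg Hom.dgHom ((free k).map_comp f g)

theorem freeUnit_naturality {M N : DGModule k} (f : M ⟶ N) :
    f ≫ freeUnit N = freeUnit M ≫ freeDGMap f :=
  (adj k).unit.naturality f

theorem freeDGMap_act_freeUnit {M N : DGModule k} (f : M ⟶ N) {r : ℕ} (π : BarrattEccles k r)
    (x : Fin r → M) :
    (freeDGMap f).lin (((free k).obj M).act r π fun i => (freeUnit M).lin (x i)) =
      ((free k).obj N).act r π fun i => (freeUnit N).lin (f.lin (x i)) := by
  refine (((free k).map f).map_act π _).trans (congrArg _ (funext fun i => ?_))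
  exact (LinearMap.congr_fun (congrArg DGModule.Hom.lin (freeUnit_naturality f)) (x i)).symm

theorem freeUnit_freeCounit_act_arity_one {M : DGModule k} (π : BarrattEccles k 1)
    (x : Fin 1 → M) :
    (freeUnit M).lin ((freeCounit M).lin
        (((free k).obj M).act 1 π fun i => (freeUnit M).lin (x i))) =
      ((free k).obj M).act 1 π fun i => (freeUnit M).lin (x i) := by
  rw [act_arity_one, map_smul, freeCounit_freeUnit_apply, map_smul]

variable (A : BEAlgebra k)

/-- The insertion of a level of unary vertices in position `j`, which is the degeneracy `s_j` on
the generators of the cotriple resolution. -/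
noncomputable def insertLevel : ∀ n : ℕ, Fin (n + 1) → (A.gens n ⟶ A.gens (n + 1))
  | 0 => fun _ => freeUnit (A.gens 0)
  | n + 1 => Fin.cases (freeUnit (A.gens (n + 1))) fun j => freeDGMap (insertLevel n j)

/-- The deletion of the level `j`: the trees such that this level does not consist of unary
vertices are sent to zero. -/
noncomputable def deleteLevel : ∀ n : ℕ, Fin (n + 1) → (A.gens (n + 1) ⟶ A.gens n)
  | 0 => fun _ => freeCounit (A.gens 0)
  | n + 1 => Fin.cases (freeCounit (A.gens (n + 1))) fun j => freeDGMap (deleteLevel n j)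

theorem insertLevel_zero (n : ℕ) : A.insertLevel n 0 = freeUnit (A.gens n) := by
  cases n <;> rfl

theorem deleteLevel_zero (n : ℕ) : A.deleteLevel n 0 = freeCounit (A.gens n) := by
  cases n <;> rfl

open Simplicial in
theorem Res_σ (n : ℕ) (j : Fin (n + 1)) :
    A.Res.σ j = (free k).map (A.insertLevel n j) := by
  induction n with
  | zero =>
    obtain rfl : j = 0 := Subsingleton.elim (α := Fin 1) j 0
    exact CotripleResolution.simplicialObject_σ_zero (adj k).toComonad A 0
  | succ n ih =>
    refine Fin.cases ?_ (fun j => ?_) j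
    · exact CotripleResolution.simplicialObject_σ_zero (adj k).toComonad A (n + 1)
    · refine (CotripleResolution.simplicialObject_σ_succ (adj k).toComonad A n j).trans ?_
      exact congrArg (fun f => (free k).map (Hom.dgHom f)) (ih j)

theorem insertLevel_deleteLevel (n : ℕ) (j : Fin (n + 1)) :
    A.insertLevel n j ≫ A.deleteLevel n j = 𝟙 _ := by
  induction n with
  | zero => exact freeUnit_freeCounit _
  | succ n ih =>
    refine Fin.cases (freeUnit_freeCounit _) (fun j => ?_) j
    exact (freeDGMap_comp _ _).symm.trans ((congrArg freeDGMap (ih j)).trans (freeDGMap_id _))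

theorem insertLevel_deleteLevel_of_le (n : ℕ) {i j : Fin (n + 1)} (h : i ≤ j) :
    A.insertLevel (n + 1) i.castSucc ≫ A.deleteLevel (n + 1) j.succ =
      A.deleteLevel n j ≫ A.insertLevel n i := by
  induction n with
  | zero =>
    obtain rfl : i = 0 := Subsingleton.elim (α := Fin 1) i 0
    exact (freeUnit_naturality _).symm
  | succ n ih =>
    rcases Fin.eq_zero_or_eq_succ i with rfl | ⟨i, rfl⟩
    · exact (freeUnit_naturality _).symm
    · obtain ⟨j, rfl⟩ := Fin.exists_succ_eq.2 (((Fin.succ_pos i).trans_le h).ne')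
      exact (freeDGMap_comp _ _).symm.trans
        ((congrArg freeDGMap (ih (Fin.succ_le_succ_iff.1 h))).trans (freeDGMap_comp _ _))

/-- The idempotent of `C_n(A)` given by the tree-wise tensors whose level `l` entirely consists
of unary vertices. -/
noncomputable def levelProj : ∀ n : ℕ, Fin n → (A.gens n ⟶ A.gens n)
  | 0 => fun l => l.elim0
  | n + 1 => fun l => A.deleteLevel n l ≫ A.insertLevel n l

theorem levelProj_eq (n : ℕ) (l : Fin (n + 1)) :
    A.levelProj (n + 1) l = A.deleteLevel n l ≫ A.insertLevel n l := rfl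

theorem levelProj_zero (n : ℕ) :
    A.levelProj (n + 1) 0 = freeCounit (A.gens n) ≫ freeUnit (A.gens n) := by
  rw [levelProj_eq, deleteLevel_zero, insertLevel_zero]
  rfl

theorem levelProj_succ (n : ℕ) (l : Fin n) :
    A.levelProj (n + 1) l.succ = freeDGMap (A.levelProj n l) := by
  cases n with
  | zero => exact l.elim0
  | succ n => exact (freeDGMap_comp _ _).symm

variable {A}

/-- A tree-wise tensor is fixed or killed by the idempotent of the level `l`, according to whether
this level consists of unary vertices. -/
theorem TreeTensor.levelProj_apply {n : ℕ} {u : Fin n → Prop} {x : A.gens n}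
    (h : TreeTensor A n u x) (l : Fin n) :
    (u l → (A.levelProj n l).lin x = x) ∧ (¬ u l → (A.levelProj n l).lin x = 0) := by
  induction h with
  | leaf ha u => exact l.elim0
  | @node n r q π hπ x u h ih =>
    refine Fin.cases ?_ (fun l => ?_) l
    · rw [levelProj_zero, Fin.cons_zero]
      constructor
      · rintro rfl
        exact freeUnit_freeCounit_act_arity_one π x
      · intro hr
        exact (congrArg (freeUnit (A.gens n)).lin (freeCounit_act hr π _)).trans (map_zero _)
    · rw [levelProj_succ, Fin.cons_succ]
      have key := freeDGMap_act_freeUnit (A.levelProj n l) π x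
      constructor
      · intro hu
        refine key.trans (congrArg _ (funext fun i => ?_))
        rw [(ih i l).1 (hu i)]
      · intro hu
        obtain ⟨i, hi⟩ := not_forall.1 hu
        refine key.trans (MultilinearMap.map_coord_zero _ i ?_)
        rw [(ih i l).2 hi, map_zero]

theorem TreeTensor.exists_insertLevel {n : ℕ} {u : Fin (n + 1) → Prop} {x : A.gens (n + 1)}
    (h : TreeTensor A (n + 1) u x) {l : Fin (n + 1)} (hl : u l) :
    ∃ y, (A.insertLevel n l).lin y = x :=
  ⟨_, (h.levelProj_apply l).1 hl⟩

theorem TreeTensor.deleteLevel_eq_zero {n : ℕ} {u : Fin (n + 1) → Prop} {x : A.gens (n + 1)}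
    (h : TreeTensor A (n + 1) u x) {l : Fin (n + 1)} (hl : ¬ u l) :
    (A.deleteLevel n l).lin x = 0 := by
  have h1 := congrArg (A.deleteLevel n l).lin ((h.levelProj_apply l).2 hl)
  rw [map_zero] at h1
  refine Eq.trans ?_ h1
  exact (LinearMap.congr_fun (congrArg DGModule.Hom.lin (A.insertLevel_deleteLevel n l))
    ((A.deleteLevel n l).lin x)).symm

/-! ### Tree-wise tensors span -/

/-- The elements of the free algebra given by one operation on homogeneous generators. -/
def oneLevel (M : DGModule k) : Set ((free k).obj M).dg :=
  {y | ∃ (r q : ℕ) (π : BarrattEccles k r) (x : Fin r → M) (p : Fin r → ℤ),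
    π ∈ BarrattEccles.gr k r q ∧ (∀ i, x i ∈ M.gr (p i)) ∧
      ((free k).obj M).act r π (fun i => (freeUnit M).lin (x i)) = y}

theorem one_mem : one k ∈ BarrattEccles.gr k 1 0 := cls_mem _

theorem freeUnit_mem_oneLevel {M : DGModule k} {p : ℤ} {x : M} (hx : x ∈ M.gr p) :
    (freeUnit M).lin x ∈ oneLevel M :=
  ⟨1, 0, one k, fun _ => x, fun _ => p, one_mem, fun _ => hx, ((free k).obj M).act_one _⟩

/-- One operation, applied to elements of the form `oneLevel`, reduces to elements of the same
form: the inner operations are absorbed from left to right by partial composites. -/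
theorem act_oneLevel_mem (M : DGModule k) (s : ℕ) : ∀ {r q : ℕ} {e : BarrattEccles k r}
    (_ : e ∈ BarrattEccles.gr k r q) (b : Fin r → ((free k).obj M).dg)
    (_ : ∀ j, b j ∈ oneLevel M)
    (_ : ∀ j : Fin r, s ≤ j.val → ∃ (p : ℤ) (x : M), x ∈ M.gr p ∧ (freeUnit M).lin x = b j),
    ((free k).obj M).act r e b ∈ Submodule.span k (oneLevel M) := by
  induction s with
  | zero =>
    intro r q e he b _ hb
    choose p x hx hxb using fun j => hb j (Nat.zero_le _)
    exact Submodule.subset_span ⟨r, q, e, x, p, he, hx, congrArg _ (funext hxb)⟩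
  | succ s ih =>
    intro r q e he b hb hb'
    by_cases hs : s < r
    swap
    · exact ih he b hb fun j hj => absurd j.2 (by omega)
    obtain ⟨m, rfl⟩ : ∃ m, r = m + 1 := ⟨r - 1, by omega⟩
    obtain ⟨n, q', f, x, p, hf, hx, hy⟩ := hb ⟨s, hs⟩
    let i : Fin (m + 1) := ⟨s, hs⟩
    let a : Fin (m + n) → ((free k).obj M).dg := fun j =>
      if h : j.val < s then b ⟨j.val, by omega⟩
      else if h' : j.val < s + n then (freeUnit M).lin (x ⟨j.val - s, by omega⟩)
      else b ⟨j.val + 1 - n, by omega⟩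
    have ha1 : innerArgs i a = fun l => (freeUnit M).lin (x l) := by
      ext1 l
      have hl := l.2
      simp only [innerArgs, a, i]
      rw [dif_neg (by omega), dif_pos (by omega)]
      congr 2
      exact Fin.ext (by simp)
    have ha2 : outerArgs i a (b i) = b := by
      ext1 j
      simp only [outerArgs, a, i]
      split_ifs with h1 h2 h3 h4
      · rfl
      · exact congrArg b (Fin.ext h2.symm)
      · omega
      · omega
      · exact congrArg b (Fin.ext (by simp; omega))
    have ha3 : ∀ j, a j ∈ oneLevel M := by
      intro j
      simp only [a]
      split_ifs
      · exact hb _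
      · exact freeUnit_mem_oneLevel (hx _)
      · exact hb _
    have ha4 : ∀ j : Fin (m + n), s ≤ j.val →
        ∃ (p : ℤ) (x : M), x ∈ M.gr p ∧ (freeUnit M).lin x = a j := by
      intro j hj
      simp only [a]
      rw [dif_neg (by omega)]
      split_ifs
      · exact ⟨_, _, hx _, rfl⟩
      · exact hb' _ (by simp; omega)
    have ha5 : ∀ j, ∃ p, a j ∈ ((free k).obj M).dg.gr p := by
      intro j
      obtain ⟨r, q, π, x, p, hπ, hx, h⟩ := ha3 j
      rw [← h]
      exact ⟨_, ((free k).obj M).act_mem hπ fun i => (freeUnit M).map_gr (hx i)⟩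
    choose p' hp' using ha5
    have key := ((free k).obj M).act_comp i e hf hp'
    rw [ha1, hy, ha2] at key
    rw [key]
    refine negOnePow_smul_mem _ _ ?_
    -- Homogeneity of `e ∘ᵢ f` is not needed: the composite is decomposed along simplices.
    generalize comp k i e f = c
    induction c using Finsupp.induction_linear with
    | zero => simp
    | add c c' hc hc' => rw [map_add]; exact Submodule.add_mem _ hc hc'
    | single σ c =>
      rw [← mul_one c, ← smul_eq_mul, ← Finsupp.smul_single, map_smul]
      exact Submodule.smul_mem _ _ (ih (FreeTerm.single_mem_gr σ) a ha3 ha4)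

theorem span_oneLevel (M : DGModule k) : Submodule.span k (oneLevel M) = ⊤ := by
  let W : Submodule k (FreeTerm.freeDG M) := Submodule.span k (oneLevel M)
  have h1 : ∀ {p : ℤ} (x : M.gr p), (unitHom M).lin x ∈ W := fun x =>
    Submodule.subset_span (freeUnit_mem_oneLevel x.2)
  have h2 : ∀ {r : ℕ} (σ : BESimplex r) (b : Fin r → FreeTerm.freeDG M), (∀ i, b i ∈ W) →
      FreeTerm.actFree M r (Finsupp.single σ 1) b ∈ W := fun {r} σ b hb =>
    (((free k).obj M).act r (Finsupp.single σ 1)).mem_of_span _ (fun _ => oneLevel M)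
      (fun b hb => act_oneLevel_mem M r (FreeTerm.single_mem_gr σ) b hb
        fun j hj => absurd j.2 (by omega)) b hb
  have h3 : ∀ t, FreeTerm.toFree M (FreeTerm.gen t) ∈ W := by
    intro t
    induction t with
    | of p x =>
      rw [← unitHom_apply]
      exact h1 x
    | node σ t ih =>
      rw [← FreeTerm.op_gen, ← FreeTerm.actLin_single, ← FreeTerm.actFree_mk]
      exact h2 σ _ ih
  have h4 : (⊤ : Submodule k (FreeTerm.Lin M)) ≤ W.comap (FreeTerm.toFree M) := by
    rw [← FreeTerm.span_gen, Submodule.span_le]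
    rintro _ ⟨t, rfl⟩
    exact h3 t
  rw [eq_top_iff]
  intro y _
  obtain ⟨y, rfl⟩ := FreeTerm.toFree_surjective y
  exact h4 trivial

theorem span_treeTensors (A : BEAlgebra k) (n : ℕ) :
    Submodule.span k {x : A.gens n | ∃ u, TreeTensor A n u x} = ⊤ := by
  induction n with
  | zero =>
    rw [eq_top_iff, ← (A.gens 0).iSup_gr]
    exact iSup_le fun p x hx => Submodule.subset_span ⟨Fin.elim0, TreeTensor.leaf hx _⟩
  | succ n ih =>
    rw [eq_top_iff]
    refine (span_oneLevel (A.gens n)).symm.le.trans (Submodule.span_le.2 ?_)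
    rintro _ ⟨r, q, π, x, p, hπ, hx, rfl⟩
    refine ((((free k).obj (A.gens n)).act r π).compLinearMap
      fun _ => (freeUnit (A.gens n)).lin).mem_of_span _
        (fun _ => {x | ∃ u, TreeTensor A n u x}) (fun y hy => ?_) x
          fun i => by rw [ih]; trivial
    choose u hu using hy
    exact @Submodule.subset_span k (A.gens (n + 1)) _ _ _ _ _ ⟨_, TreeTensor.node hπ hu⟩

end BEAlgebra

/-! ### The degenerate part of the generators -/

/-- A family of morphisms `f j` on split subobjects `t j : X ⟶ Y` extends to `Y` when it is
compatible on the intersections of these subobjects. The extension can be chosen to vanish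
where all retractions `q j` vanish. -/
theorem CategoryTheory.Preadditive.exists_common_extension {C : Type*} [Category C]
    [Preadditive C] {X Y V : C} {m : ℕ} (t : Fin m → (X ⟶ Y)) (q : Fin m → (Y ⟶ X))
    (f : Fin m → (X ⟶ V)) (ht : ∀ j, t j ≫ q j = 𝟙 X)
    (h : ∀ i j, i < j → ∃ p : X ⟶ X, t i ≫ q j ≫ t j = p ≫ t i ∧ t i ≫ q j ≫ f j = p ≫ f i) :
    ∃ F : Y ⟶ V, (∀ j, t j ≫ F = f j) ∧ ∃ c : Fin m → (X ⟶ V), F = ∑ j, q j ≫ c j := by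
  induction m with
  | zero => exact ⟨0, fun j => j.elim0, fun j => j.elim0, by simp⟩
  | succ m ih =>
    obtain ⟨F, hF, c, hc⟩ := ih (fun j => t j.castSucc) (fun j => q j.castSucc)
      (fun j => f j.castSucc) (fun j => ht j.castSucc)
      (fun i j hij => h i.castSucc j.castSucc hij)
    let l := Fin.last m
    -- The correction makes the extension right on `t l`, and vanishes on the previous `t i`.
    refine ⟨F + q l ≫ (f l - t l ≫ F), fun j => ?_, Fin.snoc c (f l - t l ≫ F), ?_⟩
    · refine Fin.lastCases ?_ (fun i => ?_) j
      · rw [Preadditive.comp_add, ← Category.assoc (t l), ht, Category.id_comp,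
          add_sub_cancel]
      · obtain ⟨p, hp1, hp2⟩ := h i.castSucc l (Fin.castSucc_lt_last i)
        have h1 : t i.castSucc ≫ q l ≫ t l ≫ F = p ≫ f i.castSucc := by
          rw [← hF i, ← Category.assoc p, ← hp1]
          simp only [Category.assoc]
        rw [Preadditive.comp_add, hF, Preadditive.comp_sub, Preadditive.comp_sub, hp2, h1,
          sub_self, add_zero]
    · rw [Fin.sum_univ_castSucc, hc]
      simp only [Fin.snoc_castSucc, Fin.snoc_last]
      rfl

namespace BEAlgebra

variable {k : Type u} [Field k]

variable (A : BEAlgebra k)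

theorem insertLevel_insertLevel (n : ℕ) {i j : Fin (n + 1)} (h : i ≤ j) :
    A.insertLevel n j ≫ A.insertLevel (n + 1) i.castSucc =
      A.insertLevel n i ≫ A.insertLevel (n + 1) j.succ := by
  induction n with
  | zero =>
    obtain rfl : i = 0 := Subsingleton.elim (α := Fin 1) i 0
    exact freeUnit_naturality _
  | succ n ih =>
    rcases Fin.eq_zero_or_eq_succ i with rfl | ⟨i, rfl⟩
    · exact freeUnit_naturality _
    · obtain ⟨j, rfl⟩ := Fin.exists_succ_eq.2 (((Fin.succ_pos i).trans_le h).ne')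
      exact (freeDGMap_comp _ _).symm.trans
        ((congrArg freeDGMap (ih (Fin.succ_le_succ_iff.1 h))).trans (freeDGMap_comp _ _))

theorem deleteLevel_comp_nondeg (n : ℕ) (j : Fin (n + 1)) :
    A.nondegIncl (n + 1) ≫ A.deleteLevel n j = 0 := by
  have h : Submodule.span k (A.nondegTreeTensors (n + 1)) ≤
      LinearMap.ker (A.deleteLevel n j).lin := by
    refine Submodule.span_le.2 ?_
    rintro x ⟨u, hu, hx⟩
    exact hx.deleteLevel_eq_zero (hu j)
  exact DGModule.hom_ext fun x => h x.2

variable {A} in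
/-- The compatibility of a family of morphisms, indexed by the degeneracies with values in
`C_{n+1}(A)`, with the simplicial identities between degeneracies. -/
def DegeneracyCompatible {V : DGModule k} : ∀ n : ℕ, (Fin (n + 1) → (A.gens n ⟶ V)) → Prop
  | 0 => fun _ => True
  | n + 1 => fun f => ∀ i j : Fin (n + 1), i ≤ j →
      A.insertLevel n j ≫ f i.castSucc = A.insertLevel n i ≫ f j.succ

/-- A compatible family on the sources of the degeneracies extends to `C_{n+1}(A)`, by zero on
`N_{n+1} C_•(A)`. -/
theorem exists_extension (n : ℕ) {V : DGModule k} (f : Fin (n + 1) → (A.gens n ⟶ V))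
    (hf : DegeneracyCompatible n f) :
    ∃ F : A.gens (n + 1) ⟶ V, (∀ j, A.insertLevel n j ≫ F = f j) ∧
      A.nondegIncl (n + 1) ≫ F = 0 := by
  obtain ⟨F, hF, c, rfl⟩ := Preadditive.exists_common_extension (A.insertLevel n)
    (A.deleteLevel n) f (A.insertLevel_deleteLevel n) (fun i j hij => by
      rcases n with _ | n
      · exact absurd hij (by simp [Subsingleton.elim (α := Fin 1) i j])
      · obtain ⟨i, rfl⟩ := Fin.exists_castSucc_eq.2 (hij.trans_le (Fin.le_last j)).ne
        obtain ⟨j, rfl⟩ := Fin.exists_succ_eq.2 ((Fin.zero_le _).trans_lt hij).ne'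
        have hij' : i ≤ j := Fin.castSucc_lt_succ_iff.1 hij
        refine ⟨A.deleteLevel n j ≫ A.insertLevel n j, ?_, ?_⟩
        · rw [← Category.assoc, A.insertLevel_deleteLevel_of_le n hij', Category.assoc,
            Category.assoc, A.insertLevel_insertLevel n hij']
        · rw [← Category.assoc, A.insertLevel_deleteLevel_of_le n hij', Category.assoc,
            Category.assoc, hf i j hij'])
  refine ⟨_, hF, ?_⟩
  rw [Preadditive.comp_sum]
  refine Finset.sum_eq_zero fun j _ => ?_
  rw [← Category.assoc, deleteLevel_comp_nondeg, zero_comp]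

/-! ### Latching objects of the cotriple resolution -/

open Simplicial

instance : IsEmpty (latchingProperty 0).FullSubcategory :=
  ⟨fun θ => Nat.not_lt_zero _ θ.property.2⟩

/-- A surjection `[n] → [m]` with `m < n`, as an object of the latching category. -/
def latchingObj {n m : ℕ} (θ : ⦋n⦌ ⟶ ⦋m⦌) [Epi θ] (h : m < n) :
    (latchingProperty n).FullSubcategory :=
  ⟨Under.mk θ, inferInstanceAs (Epi θ), h⟩

/-- The degeneracy operator `σ j`, as an object of the latching category. -/
def latchingσ {n : ℕ} (j : Fin (n + 1)) : (latchingProperty (n + 1)).FullSubcategory :=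
  latchingObj (SimplexCategory.σ j) n.lt_succ_self

/-- The objects of the latching category factor through degeneracy operators. -/
theorem exists_latchingσ_hom {n : ℕ} (θ : (latchingProperty (n + 1)).FullSubcategory) :
    ∃ j : Fin (n + 1), Nonempty (latchingσ j ⟶ θ) := by
  obtain ⟨j, θ', h⟩ := SimplexCategory.eq_σ_comp_of_not_injective θ.obj.hom fun hinj => by
    have := SimplexCategory.mono_iff_injective.2 hinj
    exact absurd (SimplexCategory.le_of_mono θ.obj.hom) (not_le.2 θ.property.2)
  exact ⟨j, ⟨ObjectProperty.homMk (Under.homMk θ' h.symm)⟩⟩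

variable {A}

/-- The component of a cocone under the latching diagram at a degeneracy operator. -/
noncomputable def latchingLeg {n : ℕ} (s : Cocone (latchingDiagram A.Res (n + 1)))
    (j : Fin (n + 1)) :
    A.Res _⦋n⦌ ⟶ s.pt :=
  s.ι.app (.op (latchingσ j))

theorem σ_latchingLeg {n : ℕ} (s : Cocone (latchingDiagram A.Res (n + 2))) {i j : Fin (n + 1)}
    (h : i ≤ j) :
    A.Res.σ j ≫ latchingLeg s i.castSucc = A.Res.σ i ≫ latchingLeg s j.succ := by
  let θ := latchingObj (SimplexCategory.σ i.castSucc ≫ SimplexCategory.σ j)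
    (n.lt_succ_self.trans (n + 1).lt_succ_self)
  let a : latchingσ i.castSucc ⟶ θ :=
    ObjectProperty.homMk (Under.homMk (SimplexCategory.σ j) rfl)
  let b : latchingσ j.succ ⟶ θ :=
    ObjectProperty.homMk (Under.homMk (SimplexCategory.σ i) (SimplexCategory.σ_comp_σ h).symm)
  exact (s.w a.op).trans (s.w b.op).symm

/-- The degeneracy operators with values in `Res_n(A)`, indexed by the latching category. -/
noncomputable def degeneracy (A : BEAlgebra k) (n : ℕ) (θ) :
    (latchingDiagram A.Res n).obj θ ⟶ A.Res _⦋n⦌ :=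
  (latchingCocone A.Res n).ι.app θ

/-- A morphism out of `Res_{n+1}(A)` extends a cocone under the latching diagram as soon as it
does so on the degeneracy operators. -/
theorem latchingCocone_comp_eq {n : ℕ} (s : Cocone (latchingDiagram A.Res (n + 1)))
    (F : A.Res _⦋n + 1⦌ ⟶ s.pt) (h : ∀ j, A.Res.σ j ≫ F = latchingLeg s j) (θ) :
    degeneracy A (n + 1) θ ≫ F = s.ι.app θ := by
  obtain ⟨j, ⟨φ⟩⟩ := exists_latchingσ_hom θ.unop
  exact (congrArg (· ≫ F) ((latchingCocone A.Res (n + 1)).w φ.op).symm).trans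
    ((Category.assoc _ _ _).trans ((congrArg _ (h j)).trans (s.w φ.op)))

/-- Morphisms out of `Res_n(A) = S(C_n(A))` correspond to morphisms of dg-modules out of
`C_n(A)`. -/
noncomputable def resHomEquiv (A : BEAlgebra k) (n : ℕ) (B : BEAlgebra k) :
    (A.Res _⦋n⦌ ⟶ B) ≃ (A.gens n ⟶ B.dg) :=
  (adj k).homEquiv (A.gens n) B

theorem resHomEquiv_σ_comp {n : ℕ} {B : BEAlgebra k} (j : Fin (n + 1))
    (F : A.Res _⦋n + 1⦌ ⟶ B) :
    A.resHomEquiv n B (A.Res.σ j ≫ F) = A.insertLevel n j ≫ A.resHomEquiv (n + 1) B F := by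
  rw [Res_σ]
  exact (adj k).homEquiv_naturality_left (A.insertLevel n j) F

theorem homEquiv_freeNondegIncl_comp {n : ℕ} {B : BEAlgebra k} (F : A.Res _⦋n⦌ ⟶ B) :
    (adj k).homEquiv (A.nondeg n) B (A.freeNondegIncl n ≫ F) =
      A.nondegIncl n ≫ A.resHomEquiv n B F :=
  (adj k).homEquiv_naturality_left (A.nondegIncl n) F

/-- A cocone under the latching diagram extends to `Res_n(A)`, by zero on `N_n C_•(A)`. -/
theorem exists_extension_zero {n : ℕ} (s : Cocone (latchingDiagram A.Res n)) :
    ∃ F : A.gens n ⟶ s.pt.dg,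
      (∀ θ, degeneracy A n θ ≫ (A.resHomEquiv n s.pt).symm F = s.ι.app θ) ∧
        A.nondegIncl n ≫ F = 0 := by
  rcases n with _ | n
  · exact ⟨0, fun θ => isEmptyElim θ.unop, comp_zero⟩
  obtain ⟨F, hF, hF'⟩ := A.exists_extension n (V := s.pt.dg)
    (fun j => A.resHomEquiv n s.pt (latchingLeg s j)) (by
      rcases n with _ | n
      · trivial
      · intro i j hij
        rw [← resHomEquiv_σ_comp, ← resHomEquiv_σ_comp, σ_latchingLeg s hij])
  refine ⟨F, latchingCocone_comp_eq s _ fun j => ?_, hF'⟩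
  refine (A.resHomEquiv n s.pt).injective ?_
  rw [resHomEquiv_σ_comp, Equiv.apply_symm_apply, hF]

/-- Morphisms out of `C_n(A)` that agree on nondegenerate and on degenerate tree-wise tensors
are equal. -/
theorem gens_hom_ext {n : ℕ} {V : DGModule k} {F G : A.gens n ⟶ V}
    (h : A.nondegIncl n ≫ F = A.nondegIncl n ≫ G)
    (h' : ∀ (u : Fin n → Prop) (x : A.gens n), TreeTensor A n u x → ∀ l, u l →
      F.lin x = G.lin x) : F = G := by
  refine DGModule.hom_ext fun x => ?_
  suffices H : (⊤ : Submodule k (A.gens n)) ≤ LinearMap.eqLocus F.lin G.lin from H trivial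
  rw [← span_treeTensors, Submodule.span_le]
  rintro x ⟨u, hx⟩
  by_cases hu : ∃ l, u l
  · obtain ⟨l, hl⟩ := hu
    exact h' u x hx l hl
  · exact LinearMap.congr_fun (congrArg DGModule.Hom.lin h)
      ⟨x, Submodule.subset_span ⟨u, not_exists.1 hu, hx⟩⟩

/-- The degeneracies and the inclusion of `S(N_n C_•(A))` are jointly epimorphic. -/
theorem Res_hom_ext {n : ℕ} {B : BEAlgebra k} {F G : A.Res _⦋n⦌ ⟶ B}
    (h : ∀ θ, degeneracy A n θ ≫ F = degeneracy A n θ ≫ G)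
    (h' : A.freeNondegIncl n ≫ F = A.freeNondegIncl n ≫ G) : F = G := by
  refine (A.resHomEquiv n B).injective (gens_hom_ext ?_ ?_)
  · rw [← homEquiv_freeNondegIncl_comp, ← homEquiv_freeNondegIncl_comp, h']
  · intro u x hx l hl
    rcases n with _ | n
    · exact l.elim0
    obtain ⟨y, rfl⟩ := hx.exists_insertLevel hl
    have key : A.insertLevel n l ≫ A.resHomEquiv (n + 1) B F =
        A.insertLevel n l ≫ A.resHomEquiv (n + 1) B G := by
      rw [← resHomEquiv_σ_comp, ← resHomEquiv_σ_comp]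
      exact congrArg _ (h (.op (latchingσ l)))
    exact LinearMap.congr_fun (congrArg DGModule.Hom.lin key) y

/-- The projection of `C_n(A)` onto the submodule spanned by the images of the degeneracies,
along `N_n C_•(A)`. -/
theorem exists_degenerate_projection (A : BEAlgebra k) (n : ℕ) :
    ∃ P : A.gens n ⟶ A.gens n, A.nondegIncl n ≫ P = 0 ∧
      (∀ (u : Fin n → Prop) (x : A.gens n), TreeTensor A n u x → ∀ l, u l → P.lin x = x) ∧
      ∀ θ, degeneracy A n θ ≫ (free k).map P =
        degeneracy A n θ := by
  rcases n with _ | n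
  · exact ⟨0, comp_zero, fun _ _ _ l => l.elim0, fun θ => isEmptyElim θ.unop⟩
  obtain ⟨P, hP, hP'⟩ := A.exists_extension n (A.insertLevel n) (by
    rcases n with _ | n
    · trivial
    · exact fun i j hij => A.insertLevel_insertLevel n hij)
  refine ⟨P, hP', fun u x hx l hl => ?_, latchingCocone_comp_eq (latchingCocone A.Res (n + 1))
    ((free k).map P) fun j => ?_⟩
  · obtain ⟨y, rfl⟩ := hx.exists_insertLevel hl
    exact LinearMap.congr_fun (congrArg DGModule.Hom.lin (hP l)) y
  · rw [Res_σ]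
    refine ((free k).map_comp _ _).symm.trans ((congrArg (free k).map (hP j)).trans ?_)
    exact (A.Res_σ n j).symm

theorem degenerate_projection_idem {n : ℕ} {P : A.gens n ⟶ A.gens n}
    (h : A.nondegIncl n ≫ P = 0)
    (h' : ∀ (u : Fin n → Prop) (x : A.gens n), TreeTensor A n u x → ∀ l, u l → P.lin x = x) :
    P ≫ P = P := by
  refine gens_hom_ext (by rw [reassoc_of% h, h, zero_comp]) fun u x hx l hl => ?_
  rw [DGModule.comp_lin, h' u x hx l hl, h' u x hx l hl]

/-- The projection of `C_n(A)` onto `N_n C_•(A)` that kills the degenerate tree-wise tensors. -/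
theorem exists_nondegenerate_projection {n : ℕ} {P : A.gens n ⟶ A.gens n}
    (h : A.nondegIncl n ≫ P = 0)
    (h' : ∀ (u : Fin n → Prop) (x : A.gens n), TreeTensor A n u x → ∀ l, u l → P.lin x = x) :
    ∃ ν : A.gens n ⟶ A.nondeg n, ν ≫ A.nondegIncl n = 𝟙 _ - P ∧ A.nondegIncl n ≫ ν = 𝟙 _ ∧
      P ≫ ν = 0 := by
  have hmem : ∀ x : A.gens n,
      DGModule.Hom.lin (𝟙 _ - P) x ∈ Submodule.span k (A.nondegTreeTensors n) := by
    suffices H : (⊤ : Submodule k (A.gens n)) ≤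
        (Submodule.span k (A.nondegTreeTensors n)).comap (DGModule.Hom.lin (𝟙 _ - P)) from
      fun x => H trivial
    rw [← span_treeTensors, Submodule.span_le]
    rintro x ⟨u, hx⟩
    change DGModule.Hom.lin (𝟙 _ - P) x ∈ Submodule.span k (A.nondegTreeTensors n)
    rw [DGModule.sub_lin, DGModule.id_lin]
    by_cases hu : ∃ l, u l
    · obtain ⟨l, hl⟩ := hu
      rw [h' u x hx l hl, sub_self]
      exact Submodule.zero_mem _
    · have hx' : x ∈ Submodule.span k (A.nondegTreeTensors n) :=
        Submodule.subset_span ⟨u, not_exists.1 hu, hx⟩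
      have : P.lin x = 0 := LinearMap.congr_fun (congrArg DGModule.Hom.lin h) ⟨x, hx'⟩
      rwa [this, sub_zero]
  let ν : A.gens n ⟶ A.nondeg n := DGModule.Hom.mk
    ((DGModule.Hom.lin (𝟙 _ - P)).codRestrict _ hmem) (DGModule.Hom.map_gr (𝟙 _ - P))
    fun x => Subtype.ext (DGModule.Hom.map_d (𝟙 _ - P) x)
  have hν : ν ≫ A.nondegIncl n = 𝟙 _ - P := rfl
  have hmono : ∀ {K : DGModule k} (f g : K ⟶ A.nondeg n),
      f ≫ A.nondegIncl n = g ≫ A.nondegIncl n → f = g := fun f g hfg =>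
    DGModule.hom_ext fun x =>
      Subtype.ext (LinearMap.congr_fun (congrArg DGModule.Hom.lin hfg) x)
  refine ⟨ν, hν, hmono _ _ ?_, hmono _ _ ?_⟩
  · rw [Category.assoc, hν, Preadditive.comp_sub, h, sub_zero, Category.comp_id,
      Category.id_comp]
  · rw [Category.assoc, hν, Preadditive.comp_sub, degenerate_projection_idem h h',
      Category.comp_id, sub_self, zero_comp]

theorem free_map_comp_resHomEquiv_symm {n : ℕ} {B : BEAlgebra k} (P : A.gens n ⟶ A.gens n)
    (F : A.gens n ⟶ B.dg) :
    (free k).map P ≫ (A.resHomEquiv n B).symm F = (A.resHomEquiv n B).symm (P ≫ F) :=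
  ((adj k).homEquiv_naturality_left_symm P F).symm

/-- A cocone under the latching diagram extends to `Res_n(A)`, with any prescribed restriction
to the free algebra on `N_n C_•(A)`. -/
theorem exists_extension_of_cocone {n : ℕ} (s : Cocone (latchingDiagram A.Res n))
    (b : (free k).obj (A.nondeg n) ⟶ s.pt) :
    ∃ F : A.Res _⦋n⦌ ⟶ s.pt, (∀ θ, degeneracy A n θ ≫ F = s.ι.app θ) ∧
      A.freeNondegIncl n ≫ F = b := by
  obtain ⟨P, hP0, hP1, hP⟩ := A.exists_degenerate_projection n
  obtain ⟨ν, hν, hν1, hν0⟩ := exists_nondegenerate_projection hP0 hP1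
  obtain ⟨F, hF, hF0⟩ := exists_extension_zero s
  let b' : A.nondeg n ⟶ s.pt.dg := (adj k).homEquiv (A.nondeg n) s.pt b
  -- The degeneracies take their values in the image of `P`, where only `F` contributes.
  have hPF : P ≫ (F + ν ≫ b') = P ≫ F := by
    rw [Preadditive.comp_add, ← Category.assoc P ν, hν0, zero_comp, add_zero]
  refine ⟨(A.resHomEquiv n s.pt).symm (F + ν ≫ b'), fun θ => ?_, ?_⟩
  · have key : ∀ G : A.gens n ⟶ s.pt.dg,
        degeneracy A n θ ≫ (A.resHomEquiv n s.pt).symm G =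
        degeneracy A n θ ≫ (A.resHomEquiv n s.pt).symm (P ≫ G) := by
      intro G
      rw [← free_map_comp_resHomEquiv_symm]
      exact (congrArg (· ≫ (A.resHomEquiv n s.pt).symm G) (hP θ)).symm.trans
        (Category.assoc _ _ _)
    rw [key, hPF, ← key, hF]
  · refine ((adj k).homEquiv (A.nondeg n) s.pt).injective ?_
    rw [homEquiv_freeNondegIncl_comp, Equiv.apply_symm_apply, Preadditive.comp_add, hF0,
      zero_add, ← Category.assoc, hν1, Category.id_comp]

theorem free_map_zero_comp {M N N' : DGModule k} {B : BEAlgebra k} (g : (free k).obj N ⟶ B)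
    (g' : (free k).obj N' ⟶ B) :
    (free k).map (0 : M ⟶ N) ≫ g = (free k).map (0 : M ⟶ N') ≫ g' := by
  refine ((adj k).homEquiv M B).injective ?_
  rw [(adj k).homEquiv_naturality_left, (adj k).homEquiv_naturality_left]
  exact zero_comp.trans zero_comp.symm

/-- The latching objects of the cotriple resolution are the free algebras on the degenerate
parts of the dg-modules `C_n(A)`. -/
theorem exists_latching_colimit (A : BEAlgebra k) (n : ℕ) :
    ∃ L : Cocone (latchingDiagram A.Res n), Nonempty (IsColimit L) := by
  obtain ⟨P, hP0, hP1, hP⟩ := A.exists_degenerate_projection n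
  obtain ⟨D, i, r, hir, hri⟩ := DGModule.exists_splitting P (degenerate_projection_idem hP0 hP1)
  let R : A.Res _⦋n⦌ ⟶ (free k).obj D := (free k).map r
  let I : (free k).obj D ⟶ A.Res _⦋n⦌ := (free k).map i
  have hIR : I ≫ R = 𝟙 _ :=
    ((free k).map_comp i r).symm.trans ((congrArg _ hir).trans ((free k).map_id D))
  have hRI : R ≫ I = (free k).map P :=
    ((free k).map_comp r i).symm.trans (congrArg _ hri)
  have hRI' : ∀ θ, degeneracy A n θ ≫ R ≫ I =
      degeneracy A n θ := fun θ => (congrArg _ hRI).trans (hP θ)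
  have hr : A.nondegIncl n ≫ r = 0 := by
    rw [← Category.comp_id r, ← hir, reassoc_of% hri, reassoc_of% hP0, zero_comp]
  have hR : A.freeNondegIncl n ≫ R = (free k).map 0 :=
    ((free k).map_comp (A.nondegIncl n) r).symm.trans (congrArg _ hr)
  choose F hF hF0 using fun s : Cocone (latchingDiagram A.Res n) =>
    exists_extension_of_cocone s ((adj k).homEquiv _ _ |>.symm 0)
  refine ⟨(latchingCocone A.Res n).extend R, ⟨⟨fun s => I ≫ F s, fun s θ => ?_,
    fun s (m : (free k).obj D ⟶ s.pt) hm => ?_⟩⟩⟩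
  · change (degeneracy A n θ ≫ R) ≫ I ≫ F s = s.ι.app θ
    rw [Category.assoc, ← hF s θ, ← Category.assoc R, ← Category.assoc _ (R ≫ I), hRI']
  · have hm' : ∀ θ, degeneracy A n θ ≫ R ≫ m = s.ι.app θ := fun θ =>
      (Category.assoc _ _ _).symm.trans (hm θ)
    have key : R ≫ m = R ≫ I ≫ F s := by
      refine Res_hom_ext (fun θ => ?_) ?_
      · rw [hm', ← hF s θ, ← Category.assoc R, ← Category.assoc _ (R ≫ I), hRI']
      · rw [← Category.assoc, ← Category.assoc, hR]
        exact free_map_zero_comp _ _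
    change m = I ≫ F s
    rw [← Category.id_comp m, ← hIR, Category.assoc, key, ← Category.assoc I R, hIR,
      Category.id_comp]

theorem latchingMap_comp {n : ℕ} {L : Cocone (latchingDiagram A.Res n)} (hL : IsColimit L)
    (θ) : L.ι.app θ ≫ latchingMap A.Res n hL = degeneracy A n θ :=
  hL.fac _ θ

/-- The free algebra on `N_n C_•(A)` is a complement of the latching object in `Res_n(A)`. -/
theorem exists_isColimit_latching (A : BEAlgebra k) (n : ℕ)
    (L : Cocone (latchingDiagram A.Res n)) (hL : IsColimit L) :
    Nonempty (IsColimit (BinaryCofan.mk (latchingMap A.Res n hL) (A.freeNondegIncl n))) := by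
  choose F hF hF' using fun s : BinaryCofan L.pt ((free k).obj (A.nondeg n)) =>
    exists_extension_of_cocone (L.extend s.inl) s.inr
  have hF1 : ∀ s, latchingMap A.Res n hL ≫ F s = s.inl := fun s => hL.hom_ext fun θ => by
    rw [← Category.assoc, latchingMap_comp]
    exact hF s θ
  refine ⟨BinaryCofan.isColimitMk F hF1 hF' fun s m h1 h2 =>
    Res_hom_ext (fun θ => ?_) (h2.trans (hF' s).symm)⟩
  rw [← latchingMap_comp hL, Category.assoc, Category.assoc, hF1 s]
  exact congrArg (L.ι.app θ ≫ ·) h1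

/-- The inclusion of a summand of a coproduct is a cofibration when its complement is a free
algebra. -/
theorem cofibrations_inl {X Y : BEAlgebra k} {M : DGModule k} {f : X ⟶ Y}
    {g : (free k).obj M ⟶ Y} (h : IsColimit (BinaryCofan.mk f g)) : cofibrations k f := by
  intro U V p hp
  refine ⟨fun {a b} sq => ?_⟩
  obtain ⟨l, hl⟩ := M.exists_lift_acyclic_fibration hp.1 hp.2
    ((adj k).homEquiv M V (g ≫ b))
  let l' : (free k).obj M ⟶ U := ((adj k).homEquiv M U).symm l
  have hl' : l' ≫ p = g ≫ b := by
    refine ((adj k).homEquiv M V).injective ?_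
    rw [(adj k).homEquiv_naturality_right, Equiv.apply_symm_apply]
    exact hl
  obtain ⟨d, hd1, hd2⟩ : ∃ d : Y ⟶ U, f ≫ d = a ∧ g ≫ d = l' :=
    ⟨h.desc (BinaryCofan.mk a l'), h.fac _ ⟨.left⟩, h.fac _ ⟨.right⟩⟩
  refine ⟨⟨⟨d, hd1, BinaryCofan.IsColimit.hom_ext h ?_ ?_⟩⟩⟩
  · change f ≫ d ≫ p = f ≫ b
    rw [← Category.assoc, hd1, sq.w]
  · change g ≫ d ≫ p = g ≫ b
    rw [← Category.assoc, hd2, hl']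

end BEAlgebra

theorem mainTheorem7 {k : Type u} [Field k] (A : BEAlgebra k) :
    A.dg.IsCofibrant ∧
    IsReedyCofibrant (BEAlgebra.cofibrations k) A.Res ∧
    ∀ (n : ℕ) (L : Cocone (latchingDiagram A.Res n)) (hL : IsColimit L),
      Nonempty (IsColimit (BinaryCofan.mk (latchingMap A.Res n hL) (A.freeNondegIncl n))) := by
  refine ⟨A.dg.isCofibrant, fun n => ?_, A.exists_isColimit_latching⟩
  obtain ⟨L, ⟨hL⟩⟩ := A.exists_latching_colimit n
  obtain ⟨h⟩ := A.exists_isColimit_latching n L hL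
  exact ⟨L, hL, BEAlgebra.cofibrations_inl h⟩
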